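/- Let $c\in\mathbb C$, $c\neq 0$. Grade the indices $1,2,3$ by $[1]=[2]=0$, $[3]=1$ in the case of $Y(2|1)=Y(\mathfrak{gl}(2|1))$, and by $[1]=0$, $[2]=[3]=1$ in the case of $Y(1|2)=Y(\mathfrak{gl}(1|2))$. The super-Yangian is the unital associative $\mathbb C$-algebra generated by $T_{ij}^{(r)}$ ($1\le i,j\le 3$, $r\ge 0$; of degree $[i]+[j]$), with defining relations, for $T_{ij}(u)=\delta_{ij}+\sum_{r\ge0}T_{ij}^{(r)}(c/u)^{r+1}$, $$T_{ij}(z)T_{kl}(w)-(-1)^{([i]+[j])([k]+[l])}T_{kl}(w)T_{ij}(z)=(-1)^{[l]([i]+[j])+[i][j]}\,g(z,w)\big(T_{il}(z)T_{kj}(w)-T_{il}(w)T_{kj}(z)\big).$$ Here and below $$g(u,v)=\frac{c}{u-v},\qquad f(u,v)=1+g(u,v),\qquad h(u,v)=\frac{f(u,v)}{g(u,v)}=\frac{u-v+c}{c}.$$ Generators of $Y(1|2)$ are written with a tilde. Let $\Omega$ be a vector of a (left) module such that $T_{ii}(u)\Omega=\lambda_i(u)\Omega$ with $\lambda_i(u)\in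 1+u^{-1}\mathbb C[[u^{-1}]]$, and $T_{ij}(u)\Omega=0$ for $i>j$; in the $Y(1|2)$ case the corresponding data are denoted $\tilde\Omega$ and $\tilde\lambda_i$. Let $\bar u=(u_1,\dots,u_a)$ and $\bar v=(v_1,\dots,v_b)$ be ordered sets of independent formal spectral parameters; all identities are between formal series in the inverse parameters, rational functions being expanded in a fixed ordering of the parameters. Put $T(u)=\sum_{i,j}{\rm E}_{ij}\otimes T_{ij}(u)$, let $X_k$ and ${\rm E}_{ij}^{(k)}$ denote copies in the $k$-th of $a+b$ auxiliary spaces $\mathbb C^3$ (all tensor products are graded, with $[{\rm E}_{ij}]=[i]+[j]$), let ${\rm str}$ be the super-trace with ${\rm str}\,{\rm E}_{ij}=(-1)^{[j]}\delta_{ij}$, and put $P=\sum_{i,j}(-1)^{[j]}{\rm E}_{ij}\otimes {\rm E}_{ji}$, $R_{a+j,k}=\mathbb I+g(v_j,u_k)P_{a+j,k}$, $$\mathbb R=(R_{a+1,a}\cdots R_{a+1,1})\cdots(R_{a+b,a}\cdots R_{a+b,1}),\qquad H(\bar w)=\prod_{k<j}h(w_j,w_k).$$ The $Y(2|1)$ Bethe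 vectors are $$\Phi_{ab}(\bar u,\bar v)=\frac{(-1)^b}{H(\bar v)}\,{\rm str}_{1\cdots a+b}\Big[T_1(u_1)\cdots T_a(u_a)T_{a+1}(v_1)\cdots T_{a+b}(v_b)\,\mathbb R\;{\rm E}_{21}^{(1)}\cdots {\rm E}_{21}^{(a)}{\rm E}_{32}^{(a+1)}\cdots {\rm E}_{32}^{(a+b)}\Big]\Omega ,$$ and the $Y(1|2)$ Bethe vectors $\tilde\Phi_{ab}(\bar u,\bar v)$ are given by the same formula with the $Y(1|2)$ grading, $\tilde T$ and $\tilde\Omega$ in place of $T$ and $\Omega$, and the prefactor $(-1)^a/H(\bar u)$. Write $\bar u_j=\bar u\setminus\{u_j\}$, $\bar v_1=\bar v\setminus\{v_1\}$; a set as an argument of $f,g,h$ stands for the product over its elements. Then for all $a\ge0$ and $b\ge1$ (for $a=0$ the sums over $j$ are empty) the $Y(2|1)$ Bethe vectors satisfy $$\Phi_{ab}(\bar u,\bar v)=h(\bar v_1,v_1)^{-1}\,T_{23}(v_1)\,\Phi_{a,b-1}(\bar u,\bar v_1)+h(\bar v_1,v_1)^{-1}\sum_{j=1}^a\lambda_2(u_j)\,g(v_1,u_j)\,f(\bar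 v_1,u_j)\,f(u_j,\bar u_j)\,T_{13}(v_1)\,\Phi_{a-1,b-1}(\bar u_j,\bar v_1),$$ and the $Y(1|2)$ Bethe vectors satisfy $$\tilde\Phi_{ab}(\bar u,\bar v)=-\tilde T_{23}(v_1)\,\tilde\Phi_{a,b-1}(\bar u,\bar v_1)-\sum_{j=1}^a\tilde\lambda_2(u_j)\,g(u_j,v_1)\,f(u_j,\bar v_1)\,g(\bar u_j,u_j)\,\tilde T_{13}(v_1)\,\tilde\Phi_{a-1,b-1}(\bar u_j,\bar v_1).$$ -/

import Mathlib

open scoped BigOperators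

noncomputable section

namespace SuperYangian

/-! ### Signs and gradings -/

/-- The sign `(-1)^x` of an element `x` of `ℤ/2`. -/
def sgn (x : ZMod 2) : ℤ := if x = 0 then 1 else -1

theorem sgn_mul_sgn (x y : ZMod 2) : sgn x * sgn y = sgn (x + y) := by
  revert x y; decide

/-- The distinguished grading of `ℂ^{2|1}`: `[1] = [2] = 0`, `[3] = 1`. -/
def parity21 : Fin 3 → ZMod 2 := ![0, 0, 1]

/-- The distinguished grading of `ℂ^{1|2}`: `[1] = 0`, `[2] = [3] = 1`. -/
def parity12 : Fin 3 → ZMod 2 := ![0, 1, 1]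

/-! ### The super-Yangian

Indices `1, 2, 3` of the auxiliary space are the elements `0, 1, 2` of `Fin 3`. -/

/-- The free associative algebra on symbols `T_ij^{(r)}`, `r ≥ 0`. -/
abbrev FreeModes : Type := FreeAlgebra ℂ (Fin 3 × Fin 3 × ℕ)

/-- The coefficient of `u^{-r}` in
`T_ij(u) = δ_ij + ∑_{r ≥ 0} T_ij^{(r)} (c/u)^{r+1}`, in the free algebra. -/
def freeCoeff (c : ℂ) (i j : Fin 3) : ℕ → FreeModes
  | 0 => if i = j then 1 else 0
  | r + 1 => c ^ (r + 1) • FreeAlgebra.ι ℂ (i, j, r)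

/-- The coefficient of `z^{-r} w^{-s}` in the graded commutator
`T_ij(z) T_kl(w) - (-1)^{([i]+[j])([k]+[l])} T_kl(w) T_ij(z)`. -/
def freeComm (p : Fin 3 → ZMod 2) (c : ℂ) (i j k l : Fin 3) (r s : ℕ) : FreeModes :=
  freeCoeff c i j r * freeCoeff c k l s
    - sgn ((p i + p j) * (p k + p l)) • (freeCoeff c k l s * freeCoeff c i j r)

/-- The defining relations of the super-Yangian: the coefficients of `z^{-r} w^{-s}` in the
componentwise form of the RTT relation multiplied by `z - w`,
`(z - w) [T_ij(z), T_kl(w)} =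
  (-1)^{[l]([i]+[j])+[i][j]} c (T_il(z) T_kj(w) - T_il(w) T_kj(z))`. -/
inductive Rel (p : Fin 3 → ZMod 2) (c : ℂ) : FreeModes → FreeModes → Prop
  | rtt (i j k l : Fin 3) (r s : ℕ) :
      Rel p c
        (freeComm p c i j k l (r + 1) s - freeComm p c i j k l r (s + 1))
        (sgn (p l * (p i + p j) + p i * p j) • c •
          (freeCoeff c i l r * freeCoeff c k j s - freeCoeff c i l s * freeCoeff c k j r))

/-- The super-Yangian attached to the grading `p` of `ℂ^3` and the constant `c`. It is
`Y(2|1)` for `p = parity21` and `Y(1|2)` for `p = parity12`. -/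
def Yangian (p : Fin 3 → ZMod 2) (c : ℂ) : Type := RingQuot (Rel p c)

instance (p : Fin 3 → ZMod 2) (c : ℂ) : Ring (Yangian p c) :=
  inferInstanceAs (Ring (RingQuot (Rel p c)))

instance (p : Fin 3 → ZMod 2) (c : ℂ) : Algebra ℂ (Yangian p c) :=
  inferInstanceAs (Algebra ℂ (RingQuot (Rel p c)))

/-- The quotient map from the free algebra to the super-Yangian. -/
def toYangian (p : Fin 3 → ZMod 2) (c : ℂ) : FreeModes →ₐ[ℂ] Yangian p c :=
  RingQuot.mkAlgHom ℂ (Rel p c)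

/-- The generator `T_ij^{(r)}` of the super-Yangian. -/
def mode (p : Fin 3 → ZMod 2) (c : ℂ) (i j : Fin 3) (r : ℕ) : Yangian p c :=
  toYangian p c (FreeAlgebra.ι ℂ (i, j, r))

/-- The series `T_ij(u)`, as a power series in `u^{-1}`. -/
def monodromySeries (p : Fin 3 → ZMod 2) (c : ℂ) (i j : Fin 3) : PowerSeries (Yangian p c) :=
  PowerSeries.mk fun r => toYangian p c (freeCoeff c i j r)

/-- The grading automorphism of the free algebra, `T_ij^{(r)} ↦ (-1)^{[i]+[j]} T_ij^{(r)}`. -/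
def freeGr (p : Fin 3 → ZMod 2) : FreeModes →ₐ[ℂ] FreeModes :=
  FreeAlgebra.lift ℂ fun x => sgn (p x.1 + p x.2.1) • FreeAlgebra.ι ℂ x

theorem freeGr_coeff (p : Fin 3 → ZMod 2) (c : ℂ) (i j : Fin 3) (r : ℕ) :
    freeGr p (freeCoeff c i j r) = sgn (p i + p j) • freeCoeff c i j r := by
  cases r with
  | zero =>
    by_cases h : i = j
    · subst h
      have h2 : ∀ x : ZMod 2, sgn (x + x) = 1 := by decide
      simp [freeCoeff, h2]
    · simp [freeCoeff, h]
  | succ r =>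
    simp only [freeCoeff, map_smul, freeGr, FreeAlgebra.lift_ι_apply]
    rw [smul_comm]

theorem freeGr_coeff_mul (p : Fin 3 → ZMod 2) (c : ℂ) (i j k l : Fin 3) (r s : ℕ) :
    freeGr p (freeCoeff c i j r * freeCoeff c k l s)
      = sgn (p i + p j + (p k + p l)) • (freeCoeff c i j r * freeCoeff c k l s) := by
  rw [map_mul, freeGr_coeff, freeGr_coeff, smul_mul_smul_comm, sgn_mul_sgn]

theorem freeGr_comm (p : Fin 3 → ZMod 2) (c : ℂ) (i j k l : Fin 3) (r s : ℕ) :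
    freeGr p (freeComm p c i j k l r s)
      = sgn (p i + p j + (p k + p l)) • freeComm p c i j k l r s := by
  rw [freeComm, map_sub, map_zsmul, freeGr_coeff_mul, freeGr_coeff_mul, smul_sub,
    add_comm (p k + p l), smul_comm]

/-- The automorphism `gr` of the super-Yangian, which multiplies an element of degree `x` by
`(-1)^x`: `T_ij^{(r)} ↦ (-1)^{[i]+[j]} T_ij^{(r)}`. It encodes the `ℤ/2`-grading. -/
def gr (p : Fin 3 → ZMod 2) (c : ℂ) : Yangian p c →ₐ[ℂ] Yangian p c :=
  RingQuot.liftAlgHom ℂ (s := Rel p c) ⟨(toYangian p c).comp (freeGr p), by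
    rintro _ _ ⟨i, j, k, l, r, s⟩
    have h : freeGr p (freeComm p c i j k l (r + 1) s - freeComm p c i j k l r (s + 1))
        = sgn (p i + p j + (p k + p l)) •
          (freeComm p c i j k l (r + 1) s - freeComm p c i j k l r (s + 1)) := by
      rw [map_sub, freeGr_comm, freeGr_comm, smul_sub]
    have h' : freeGr p (sgn (p l * (p i + p j) + p i * p j) • c •
          (freeCoeff c i l r * freeCoeff c k j s - freeCoeff c i l s * freeCoeff c k j r))
        = sgn (p i + p j + (p k + p l)) • (sgn (p l * (p i + p j) + p i * p j) • c •
          (freeCoeff c i l r * freeCoeff c k j s - freeCoeff c i l s * freeCoeff c k j r)) := by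
      have e : p i + p l + (p k + p j) = p i + p j + (p k + p l) := by ring
      rw [map_zsmul, map_smul, map_sub, freeGr_coeff_mul, freeGr_coeff_mul, e, ← smul_sub,
        smul_comm c, smul_comm (sgn (p l * (p i + p j) + p i * p j))]
    rw [AlgHom.comp_apply, AlgHom.comp_apply, h, h', map_zsmul, map_zsmul]
    congr 1
    exact RingQuot.mkAlgHom_rel ℂ (Rel.rtt i j k l r s)⟩

/-! ### Formal spectral parameters

The spectral parameters are `N` independent formal variables `x_0, …, x_{N-1}`. Everything is
expanded in their inverses: we use Hahn series with exponents in `ℤ^N`, ordered lexicographically,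
where the exponent `e` stands for the monomial `∏ x_k^{-e_k}`. With coefficients in `ℂ` these
series form a field, which contains the rational functions of the parameters and the power series
in the inverse of each parameter. -/

/-- Exponents of monomials in the inverse spectral parameters. -/
abbrev Expo (N : ℕ) : Type := Lex (Fin N → ℤ)

/-- The field of scalar functions of the spectral parameters. -/
abbrev Scal (N : ℕ) : Type := HahnSeries (Expo N) ℂ

/-- Series in the spectral parameters with coefficients in the super-Yangian. -/
abbrev YSeries (N : ℕ) (p : Fin 3 → ZMod 2) (c : ℂ) : Type :=
  HahnSeries (Expo N) (Yangian p c)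

/-- The exponents `n ↦ n e_k` of the powers of `x_k^{-1}`. -/
def invPow {N : ℕ} (k : Fin N) : ℕ ↪o Expo N :=
  OrderEmbedding.ofStrictMono (fun n : ℕ => toLex (Pi.single k (n : ℤ))) (by
    intro a b hab
    refine ⟨k, ?_, ?_⟩
    · intro j hj
      simp [Pi.single_eq_of_ne hj.ne]
    · simpa using hab)

/-- The substitution of the parameter `x_k` for `u` in a power series in `u^{-1}`. -/
def evalAt {N : ℕ} {R : Type*} [Semiring R] (k : Fin N) (F : PowerSeries R) :
    HahnSeries (Expo N) R :=
  HahnSeries.embDomain (invPow k) (HahnSeries.toPowerSeries.symm F)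

/-- The spectral parameter `x_k`, as an element of the field of scalars. -/
def par {N : ℕ} (k : Fin N) : Scal N :=
  HahnSeries.single (toLex (Pi.single k (-1 : ℤ))) 1

/-- `g(x, y) = c / (x - y)`. -/
def gFun {N : ℕ} (c : ℂ) (x y : Fin N) : Scal N := HahnSeries.C c / (par x - par y)

/-- `f(x, y) = 1 + g(x, y)`. -/
def fFun {N : ℕ} (c : ℂ) (x y : Fin N) : Scal N := 1 + gFun c x y

/-- `h(x, y) = f(x, y) / g(x, y)`. -/
def hFun {N : ℕ} (c : ℂ) (x y : Fin N) : Scal N := fFun c x y / gFun c x y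

/-- `H(v) = ∏_{k < j} h(v_j, v_k)`. -/
def bigH {N : ℕ} (c : ℂ) (v : List (Fin N)) : Scal N :=
  ∏ k : Fin v.length, ∏ j ∈ Finset.Ioi k, hFun c (v.get j) (v.get k)

/-- A scalar, seen as a series with coefficients in the super-Yangian. -/
def scal {N : ℕ} (p : Fin 3 → ZMod 2) (c : ℂ) (x : Scal N) : YSeries N p c :=
  x.map (algebraMap ℂ (Yangian p c))

/-- The grading automorphism, applied to the coefficients of a series. -/
def grSeries {N : ℕ} (p : Fin 3 → ZMod 2) (c : ℂ) (X : YSeries N p c) : YSeries N p c :=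
  X.map (gr p c)

/-- The element `T_ij(x_k)`. -/
def monodromy {N : ℕ} (p : Fin 3 → ZMod 2) (c : ℂ) (i j : Fin 3) (k : Fin N) : YSeries N p c :=
  evalAt k (monodromySeries p c i j)

/-! ### The graded tensor product of the auxiliary spaces and the algebra

An element of `End(ℂ^3)^{⊗ n} ⊗ B` (graded tensor product) is written uniquely as
`∑ E_{I_1 J_1}^{(1)} ⋯ E_{I_n J_n}^{(n)} ⊗ X_{I J}`, and is encoded by its coefficients
`X I J ∈ B`. Here `B` is a superalgebra, with grading automorphism `γ`. -/

/-- Coefficients of an element of `End(ℂ^3)^{⊗ n} ⊗ B`. -/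
abbrev Aux (n : ℕ) (B : Type*) : Type _ := (Fin n → Fin 3) → (Fin n → Fin 3) → B

/-- The unit `𝕀 ⊗ ⋯ ⊗ 𝕀 ⊗ 1`. -/
def auxOne (n : ℕ) (B : Type*) [Ring B] : Aux n B := fun I J => if I = J then 1 else 0

/-- The product in the graded tensor product. Moving `E_{J_s L_s}^{(s)}` to the left through
`E_{I_r J_r}^{(r)}`, `r > s`, and all of them through the coefficient `X I J`, gives the signs. -/
def auxMul {n : ℕ} {B : Type*} [Ring B] (p : Fin 3 → ZMod 2) (γ : B → B) (X Y : Aux n B) :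
    Aux n B := fun I L =>
  ∑ J, sgn (∑ s, ∑ r ∈ Finset.Ioi s, (p (I r) + p (J r)) * (p (J s) + p (L s))) •
    ((if ∑ s, (p (J s) + p (L s)) = 0 then X I J else γ (X I J)) * Y J L)

/-- The ordered product of a list of elements. -/
def auxProd {n : ℕ} {B : Type*} [Ring B] (p : Fin 3 → ZMod 2) (γ : B → B)
    (l : List (Aux n B)) : Aux n B :=
  l.foldr (auxMul p γ) (auxOne n B)

/-- The element `∑_ij E_ij^{(s)} ⊗ M_ij`. -/
def atSite {n : ℕ} {B : Type*} [Ring B] (s : Fin n) (M : Fin 3 → Fin 3 → B) : Aux n B :=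
  fun I J => if ∀ r, r ≠ s → I r = J r then M (I s) (J s) else 0

/-- The element `E_ij^{(s)}`. -/
def elemAt {n : ℕ} (B : Type*) [Ring B] (s : Fin n) (i j : Fin 3) : Aux n B :=
  atSite s fun k l => if k = i ∧ l = j then 1 else 0

/-- The graded permutation `P_{st} = ∑_ij (-1)^{[j]} E_ij^{(s)} E_ji^{(t)}`. -/
def permOp {n : ℕ} (B : Type*) [Ring B] (p : Fin 3 → ZMod 2) (γ : B → B) (s t : Fin n) :
    Aux n B :=
  ∑ i, ∑ j, sgn (p j) • auxMul p γ (elemAt B s i j) (elemAt B t j i)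

/-- `𝕀 + a P_{st}`, where `a` is a scalar. -/
def rMatrix {n : ℕ} {B : Type*} [Ring B] (p : Fin 3 → ZMod 2) (γ : B → B) (a : B)
    (s t : Fin n) : Aux n B :=
  auxOne n B + fun I J => a * permOp B p γ s t I J

/-- The super-trace over all the auxiliary spaces. -/
def superTrace {n : ℕ} {B : Type*} [Ring B] (p : Fin 3 → ZMod 2) (X : Aux n B) : B :=
  ∑ I, sgn (∑ s, p (I s)) • X I I

/-! ### Bethe vectors -/

/-- With `a = #u` and `b = #v`, the super-trace
`str [T_1(u_1) ⋯ T_a(u_a) T_{a+1}(v_1) ⋯ T_{a+b}(v_b) ℝ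
  E_21^{(1)} ⋯ E_21^{(a)} E_32^{(a+1)} ⋯ E_32^{(a+b)}]`, where
`ℝ = (R_{a+1,a} ⋯ R_{a+1,1}) ⋯ (R_{a+b,a} ⋯ R_{a+b,1})` and
`R_{a+j,k} = 𝕀 + g(v_j, u_k) P_{a+j,k}`. -/
def traceElement {N : ℕ} (p : Fin 3 → ZMod 2) (c : ℂ) (u v : List (Fin N)) : YSeries N p c :=
  let γ : YSeries N p c → YSeries N p c := grSeries p c
  let siteU : Fin u.length → Fin (u.length + v.length) := Fin.castAdd v.length
  let siteV : Fin v.length → Fin (u.length + v.length) := Fin.natAdd u.length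
  superTrace p (auxProd p γ (
    (List.ofFn fun k => atSite (siteU k) fun i j => monodromy p c i j (u.get k)) ++
    (List.ofFn fun k => atSite (siteV k) fun i j => monodromy p c i j (v.get k)) ++
    (List.ofFn fun j => (List.ofFn fun k =>
      rMatrix p γ (scal p c (gFun c (v.get j) (u.get k))) (siteV j) (siteU k)).reverse).flatten ++
    (List.ofFn fun k => elemAt (YSeries N p c) (siteU k) 1 0) ++
    (List.ofFn fun k => elemAt (YSeries N p c) (siteV k) 2 1)))

/-- Series in the spectral parameters with coefficients in a module `V` over the super-Yangian;
they form a module over `YSeries N p c`. -/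
abbrev VSeries (N : ℕ) (p : Fin 3 → ZMod 2) (c : ℂ) (V : Type*) [AddCommGroup V]
    [Module (Yangian p c) V] : Type _ :=
  HahnModule (Expo N) (Yangian p c) V

/-- A vector of `V`, seen as a constant series. -/
def constVec {N : ℕ} (p : Fin 3 → ZMod 2) (c : ℂ) {V : Type*} [AddCommGroup V]
    [Module (Yangian p c) V] (w : V) : VSeries N p c V :=
  HahnModule.of (Yangian p c) (HahnSeries.single 0 w)

/-- `Ω` is a singular vector, with `T_ii(u) Ω = λ_i(u) Ω`, where
`λ_i(u) = 1 + ∑_{r ≥ 0} λ_i^{(r)} (c/u)^{r+1}`, and `T_ij(u) Ω = 0` for `i > j`. -/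
structure IsSingular (p : Fin 3 → ZMod 2) (c : ℂ) {V : Type*} [AddCommGroup V]
    [Module (Yangian p c) V] (Ω : V) (lam : Fin 3 → ℕ → ℂ) : Prop where
  diag : ∀ i r, mode p c i i r • Ω = algebraMap ℂ (Yangian p c) (lam i r) • Ω
  lower : ∀ i j r, j < i → mode p c i j r • Ω = 0

/-- The weight `λ(x_k) = 1 + ∑_{r ≥ 0} λ^{(r)} (c/x_k)^{r+1}`. -/
def weight {N : ℕ} (c : ℂ) (lam : ℕ → ℂ) (k : Fin N) : Scal N :=
  evalAt k (PowerSeries.mk fun r => Nat.casesOn r 1 fun s => lam s * c ^ (s + 1))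

/-- The Bethe vector `Φ_{a,b}(u, v)` of `Y(2|1)`, `a = #u`, `b = #v`. -/
def Phi21 {N : ℕ} (c : ℂ) {V : Type*} [AddCommGroup V] [Module (Yangian parity21 c) V]
    (Ω : V) (u v : List (Fin N)) : VSeries N parity21 c V :=
  scal parity21 c ((-1) ^ v.length / bigH c v) •
    traceElement parity21 c u v • constVec parity21 c Ω

/-- The Bethe vector `Φ̃_{a,b}(u, v)` of `Y(1|2)`, `a = #u`, `b = #v`. -/
def Phi12 {N : ℕ} (c : ℂ) {V : Type*} [AddCommGroup V] [Module (Yangian parity12 c) V]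
    (Ω : V) (u v : List (Fin N)) : VSeries N parity12 c V :=
  scal parity12 c ((-1) ^ u.length / bigH c u) •
    traceElement parity12 c u v • constVec parity12 c Ω

end SuperYangian

end

open SuperYangian

/-! Since the elements `E_21`, `E_32` select a single entry, the super-trace is one matrix element
of `T_1 ⋯ T_{a+b} ℝ`, from the indices `(1^a, 2^b)` to `(2^a, 3^b)`. The RTT relation turns this
product into `∏_j (R_{a+j,a} ⋯ R_{a+j,1} T_{a+j}(v_j))` times `T_1(u_1) ⋯ T_a(u_a)`. In this order
the matrix element is a lattice sum. The `a` vertical lines start with index `1`; each horizontal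
line `v_j` enters from the right with index `2`, crosses them, leaves with some index `i ∈ {1, 2}`,
and contributes `T_{i3}(v_j)`. The vertical lines finally contribute `T_{k2}(u)`. This is
`traceElement_eq`, with `latticeWord` as the lattice sum. Both gradings are covered by one sign `ε =
(-1)^{[2]}`, equal to `1` for `Y(2|1)` and `-1` for `Y(1|2)`.

The recursion comes from following the first line `v_1` only (`latticeWord_recursion`). If it leaves
with index `2`, the row is unchanged, which gives the `T_23(v_1)` term. Otherwise it leaves with
index `1` and drops its `2` on one vertical line, which gives `T_13(v_1)` times a sum over positions
(`crossLine_ones`, `hop`). The commutation relations of `T_12`, `T_22` among themselves make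
neighbouring vertical lines exchangeable, and this property survives the crossing of further
horizontal lines (`exchange_crossLine`, a Yang-Baxter argument). Hence the `2` can be carried, with
its parameter, to the right end of the row (`hop_eq_sum`). There the remaining horizontal lines see
it only through a scalar (`latticeWord_append_true`), and `T_22(u_j)` reaches the singular vector
and becomes `λ_2(u_j)`.

All signs of the graded tensor product are absorbed once, by `hat`, a twist that turns graded
multiplication by even elements into matrix multiplication. The grading is shifted there to `π = p +
1`: only differences of degrees matter, and the shift makes index `3` even, so that finished
horizontal lines no longer produce signs. What remains is to compare the coefficients with the
normalisation `H` (`bigH_cons`, `hopCoeff_one`, `hopCoeff_neg_one`). -/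

noncomputable section

namespace SuperYangian

/-! ### Lattice states

A row of `a` vertical lines is a list of pairs `(i, x)`, where `i` is `false` for the index `1`
and `true` for the index `2`, and `x` is the spectral parameter of the line. -/

section Lattice

variable {S X M : Type*} [CommRing S] [AddCommGroup M] [Module S M]

/-- A horizontal line with parameter `v` enters a row from the right with index `2` and crosses
it: `st` and `ex` are the weights for passing straight through a vertical line and for exchanging
the indices. The outgoing states are summed against `F`. -/
def crossLine (st : Bool → Bool → S) (ex : X → X → S) (v : X) :
    List (Bool × X) → (Bool → List (Bool × X) → M) → M
  | [], F => F true []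
  | s :: r, F => crossLine st ex v r fun i r' =>
      st i s.1 • F i (s :: r') + ex v s.2 • F s.1 ((i, s.2) :: r')

variable (st : Bool → Bool → S) (ex : X → X → S) (v : X)

theorem crossLine_lin (a b : S) (w : List (Bool × X)) (F G : Bool → List (Bool × X) → M) :
    crossLine st ex v w (fun i r => a • F i r + b • G i r)
      = a • crossLine st ex v w F + b • crossLine st ex v w G := by
  induction w generalizing F G with
  | nil => rfl
  | cons s r ih =>
    simp only [crossLine]
    rw [← ih]
    congr 1
    funext i r'
    module

theorem crossLine_smul (a : S) (w : List (Bool × X)) (F : Bool → List (Bool × X) → M) :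
    crossLine st ex v w (fun i r => a • F i r) = a • crossLine st ex v w F := by
  simpa using crossLine_lin st ex v a 0 w F F

theorem crossLine_scale (δ : S) (w : List (Bool × X)) (F : Bool → List (Bool × X) → M) :
    crossLine (fun i k => δ * st i k) (fun x y => δ * ex x y) v w F
      = δ ^ w.length • crossLine st ex v w F := by
  induction w generalizing F with
  | nil => simp [crossLine]
  | cons s r ih =>
    simp only [crossLine, ih, List.length_cons]
    rw [pow_succ, mul_smul, ← crossLine_smul st ex v δ]
    refine congrArg (fun m : M => δ ^ r.length • m) ?_
    refine congrArg (crossLine st ex v r) ?_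
    funext i r'
    module

/-- The sign `ε` for two indices `1`, and `1` otherwise. -/
def bSign (ε : S) (k l : Bool) : S := if k = false ∧ l = false then ε else 1

/-- The exchange relation of the neighbouring vertical lines with parameters `x`, `y`. -/
def Exchange (ε g : S) (x y : X) (Ψ : List (Bool × X) → M) : Prop :=
  ∀ pre k l post, (1 - ε * g) • Ψ (pre ++ (k, x) :: (l, y) :: post)
      + (ε * g) • Ψ (pre ++ (k, y) :: (l, x) :: post)
    = bSign ε k l • Ψ (pre ++ (l, y) :: (k, x) :: post)

/-- The exchange of two vertical lines can be pulled through a horizontal line. This is the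
Yang-Baxter equation for the crossing weights, and `hrel` is the only property of `g` that it needs.
-/
theorem exchange_crossLine {ε : S} (hε : ε * ε = 1) {g : X → X → S} {x y v : X}
    (hrel : g x y * (g v x - g v y) = g v x * g v y) (F : Bool → List (Bool × X) → M)
    (hF : ∀ i, Exchange ε (g x y) x y (F i)) :
    Exchange ε (g x y) x y fun w => crossLine (bSign ε) (fun a b => ε * g a b) v w F := by
  intro pre
  induction pre generalizing F with
  | nil =>
    intro k l post
    simp only [List.nil_append, crossLine]
    rw [← crossLine_lin, ← crossLine_smul]
    congr 1
    funext j r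
    have h1 := hF j [] k l r
    have h2 := hF k [] j l r
    have h3 := hF l [] k j r
    have h4 := hF k [] l j r
    simp only [List.nil_append] at h1 h2 h3 h4
    rw [← sub_eq_zero] at h1 h2 h3 h4 ⊢
    -- The four multipliers are the weights of the four ways to cross the two lines: straight or
    -- exchange at each. The index pair presented to `F` differs in each.
    linear_combination (norm := skip) (bSign ε j l * bSign ε j k) • h1
      + (bSign ε j l * (ε * g v x)) • h2 + ((ε * g v y) * bSign ε l k) • h3
      + ((ε * g v y) * (ε * g v x)) • h4
    -- For fixed indices some of the states coincide; comparing their coefficients leaves multiples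
    -- of `hrel` and of `ε ^ 2 = 1`.
    cases j <;> cases k <;> cases l <;>
      simp only [bSign, and_self, and_true, and_false, if_true, if_false, Bool.true_eq_false] <;>
      match_scalars <;> first
        | ring1
        | linear_combination (ε * ε) * hrel
        | linear_combination (-ε * ε) * hrel
        | linear_combination (-ε ^ 3) * hrel + ε * g v x * hε
        | linear_combination ε ^ 3 * hrel - ε * g v x * hε
  | cons s pre ih =>
    intro k l post
    simp only [List.cons_append, crossLine]
    refine ih _ (fun i pre' k' l' post' => ?_) k l post
    have h1 := hF i (s :: pre') k' l' post'
    have h2 := hF s.1 ((i, s.2) :: pre') k' l' post'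
    simp only [List.cons_append] at h1 h2
    linear_combination (norm := module) (bSign ε i s.1) • h1 + (ε * g v s.2) • h2

/-- A row of vertical lines with index `1`. -/
def ones (w : List X) : List (Bool × X) := w.map (Prod.mk false)

@[simp] theorem ones_nil : ones ([] : List X) = [] := rfl

@[simp] theorem ones_cons (x : X) (w : List X) : ones (x :: w) = (false, x) :: ones w := rfl

/-- The sum over the positions at which a horizontal line with parameter `z` leaves its index `2`
in a row of indices `1`. -/
def hop (ε : S) (g : X → X → S) (z : X) : List X → (List (Bool × X) → M) → M
  | [], _ => 0
  | x :: w, Ψ => (ε * g z x) • Ψ ((true, x) :: ones w)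
      + (ε * (1 + g z x)) • hop ε g z w fun r => Ψ ((false, x) :: r)

theorem hop_smul (ε : S) (g : X → X → S) (z : X) (a : S) (w : List X)
    (Ψ : List (Bool × X) → M) :
    hop ε g z w (fun r => a • Ψ r) = a • hop ε g z w Ψ := by
  induction w generalizing Ψ with
  | nil => simp [hop]
  | cons x w ih =>
    simp only [hop, ih]
    module

theorem map_hop {M' : Type*} [AddCommGroup M'] [Module S M'] (φ : M →ₗ[S] M') (ε : S)
    (g : X → X → S) (z : X) (w : List X) (Ψ : List (Bool × X) → M) :
    φ (hop ε g z w Ψ) = hop ε g z w fun r => φ (Ψ r) := by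
  induction w generalizing Ψ with
  | nil => simp [hop]
  | cons x w ih => simp [hop, ih]

/-- While it carries index `2`, the line either passes a vertical line with weight `1` or exchanges
with it. After an exchange it carries `1` among `1`s, where straight passage and exchange give the
same state with total weight `ε (1 + g)`. Thus at most one vertical line receives the `2`. -/
theorem crossLine_ones (ε : S) (g : X → X → S) (z : X) (w : List X)
    (F : Bool → List (Bool × X) → M) :
    crossLine (bSign ε) (fun a b => ε * g a b) z (ones w) F
      = F true (ones w) + hop ε g z w (F false) := by
  induction w generalizing F with
  | nil => simp [crossLine, hop]
  | cons x w ih =>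
    have key : (fun r => bSign ε false false • F false ((false, x) :: r)
        + (ε * g z x) • F false ((false, x) :: r))
        = fun r => (ε * (1 + g z x)) • F false ((false, x) :: r) := by
      funext r
      simp only [bSign, and_self, if_true]
      module
    simp only [ones_cons, crossLine, ih, hop, key, hop_smul]
    simp only [bSign, Bool.true_eq_false, false_and, if_false, one_smul, add_assoc]

theorem Exchange.cons {ε g : S} {x y : X} {Ψ : List (Bool × X) → M} (h : Exchange ε g x y Ψ)
    (s : Bool × X) : Exchange ε g x y fun r => Ψ (s :: r) := fun pre => h (s :: pre)

/-- Moving an index `2` with its parameter to the end of a row of indices `1`. -/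
theorem moveToEnd {ε : S} {g : X → X → S} (x : X) (w : List X)
    (Ψ : List (Bool × X) → M) (hanti : ∀ y ∈ w, g y x = -g x y)
    (hΨ : ∀ y ∈ w, Exchange ε (g y x) y x Ψ) :
    Ψ ((true, x) :: ones w) + hop ε g x w (fun r => Ψ ((false, x) :: r))
      = (w.map fun y => 1 + ε * g x y).prod • Ψ (ones w ++ [(true, x)]) := by
  induction w generalizing Ψ with
  | nil => simp [hop]
  | cons y w ih =>
    have hy := hanti y (by simp)
    have h1 := hΨ y (by simp)
    have e1 := h1 [] false true (ones w)
    -- For two indices `1` the exchange relation has only two distinct states, so it permutes the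
    -- parameters up to a factor.
    have e2 : (fun r => (1 + ε * g x y) • Ψ ((false, y) :: (false, x) :: r))
        = fun r => (ε * (1 + g x y)) • Ψ ((false, x) :: (false, y) :: r) := by
      funext r
      have := h1 [] false false r
      simp only [hy, bSign, and_self, if_true, List.nil_append] at this
      linear_combination (norm := module) this
    have e3 := congrArg (hop ε g x w) e2
    rw [hop_smul, hop_smul] at e3
    have e4 := ih (fun r => Ψ ((false, y) :: r)) (fun z hz => hanti z (by simp [hz]))
      fun z hz => (hΨ z (by simp [hz])).cons _
    simp only [hy, bSign, Bool.true_eq_false, and_false, if_false, List.nil_append, one_smul]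
      at e1
    simp only [ones_cons, hop, List.map_cons, List.prod_cons, List.cons_append, mul_smul]
    rw [← e4]
    linear_combination (norm := module) -e1 - e3

/-- The coefficient of the `j`-th term in the expansion of `hop`. -/
def hopCoeff (ε : S) (g : X → X → S) (w : List X) (j : Fin w.length) : S :=
  ((w.take j).map fun y => ε * (1 + g (w.get j) y)).prod
    * ((w.drop (j + 1)).map fun y => 1 + ε * g (w.get j) y).prod

/-- By `moveToEnd`, the term with the `2` on the first line equals the sorted term minus a `hop`
whose parameter is that of this line. Both remaining sums are `hop`s over the tail, with parameters
`z` and `x`, so the induction has to be uniform in `z`; their coefficients combine by the relation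
for `g`. -/
theorem hop_eq_sum {ε : S} {g : X → X → S}
    (hanti : ∀ x y, x ≠ y → g y x = -g x y)
    (hrel : ∀ v x y, v ≠ x → v ≠ y → x ≠ y → g x y * (g v x - g v y) = g v x * g v y)
    (z : X) (w : List X) (hw : (z :: w).Nodup) (Ψ : List (Bool × X) → M)
    (hΨ : ∀ x ∈ w, ∀ y ∈ w, x ≠ y → Exchange ε (g x y) x y Ψ) :
    hop ε g z w Ψ = ∑ j : Fin w.length, (ε * g z (w.get j) * hopCoeff ε g w j) •
      Ψ (ones (w.eraseIdx j) ++ [(true, w.get j)]) := by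
  induction w generalizing Ψ z with
  | nil => simp [hop]
  | cons x w ih =>
    simp only [List.nodup_cons, List.mem_cons, not_or] at hw
    obtain ⟨⟨hzx, hzw⟩, hxw, hn⟩ := hw
    have hΨ' : ∀ a ∈ w, ∀ b ∈ w, a ≠ b → Exchange ε (g a b) a b fun r => Ψ ((false, x) :: r) :=
      fun a ha b hb hab => (hΨ a (by simp [ha]) b (by simp [hb]) hab).cons _
    have e1 := ih z (by simp [hzw, hn]) (fun r => Ψ ((false, x) :: r)) hΨ'
    have e2 := ih x (by simp [hxw, hn]) (fun r => Ψ ((false, x) :: r)) hΨ'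
    have hne : ∀ y ∈ w, x ≠ y := fun y hy h => hxw (h ▸ hy)
    have e3 := moveToEnd x w Ψ (fun y hy => hanti x y (hne y hy))
      fun y hy => hΨ y (by simp [hy]) x (by simp) (hne y hy).symm
    refine Eq.trans ?_ (Fin.sum_univ_succ (n := w.length) _).symm
    rw [hop, eq_sub_of_add_eq e3, e1, e2, smul_sub, Finset.smul_sum,
      Finset.smul_sum]
    have : ∀ j : Fin w.length, (ε * g z ((x :: w).get j.succ) * hopCoeff ε g (x :: w) j.succ) •
        Ψ (ones ((x :: w).eraseIdx j.succ) ++ [(true, (x :: w).get j.succ)])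
        = (ε * (1 + g z x)) • (ε * g z (w.get j) * hopCoeff ε g w j) •
            Ψ ((false, x) :: (ones (w.eraseIdx j) ++ [(true, w.get j)]))
          - (ε * g z x) • (ε * g x (w.get j) * hopCoeff ε g w j) •
            Ψ ((false, x) :: (ones (w.eraseIdx j) ++ [(true, w.get j)])) := by
      intro j
      have hj : w.get j ∈ w := List.get_mem _ _
      have r1 := hrel z x (w.get j) hzx (fun h => hzw (h ▸ hj)) (hne _ hj)
      have r2 := hanti x (w.get j) (hne _ hj)
      have hg : (x :: w).get j.succ = w.get j := rfl
      simp only [hopCoeff, hg, Fin.val_succ, List.eraseIdx_cons_succ, ones_cons,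
        List.take_succ_cons, List.drop_succ_cons, List.map_cons, List.prod_cons, List.cons_append]
      rw [r2]
      generalize (List.map (fun y => ε * (1 + g (w.get j) y)) (List.take (j : ℕ) w)).prod = A
      generalize (List.map (fun y => 1 + ε * g (w.get j) y) (List.drop (j + 1 : ℕ) w)).prod = B
      match_scalars
      -- With `y = w.get j`, this is `(1 + g z x) g z y - g z x g x y = g z y (1 + g y x)`, which
      -- creates the new factor of `hopCoeff`.
      linear_combination (ε ^ 2 * A * B) * r1
    simp only [this, Finset.sum_sub_distrib]
    have hg : (x :: w).get (0 : Fin (w.length + 1)) = x := rfl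
    simp only [hopCoeff, hg, Fin.val_zero, List.eraseIdx_cons_zero, List.take_zero,
      List.map_nil, List.prod_nil, one_mul, zero_add, List.drop_succ_cons, List.drop_zero]
    module

end Lattice

/-! ### Words of several horizontal lines and their recursion -/

section BetheWord

variable {S X A : Type*} [CommRing S] [Ring A] [Algebra S A]

/-- The operator obtained by sending horizontal lines with parameters `v` through a row. -/
def latticeWord (st : Bool → Bool → S) (ex : X → X → S) (t₂ t₃ : Bool → X → A) :
    List X → List (Bool × X) → A
  | [], w => (w.map fun s => t₂ s.1 s.2).prod
  | v :: v', w => crossLine st ex v w fun i r => t₃ i v * latticeWord st ex t₂ t₃ v' r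

theorem crossLine_map {M M' : Type*} [AddCommGroup M] [Module S M] [AddCommGroup M'] [Module S M']
    (φ : M →ₗ[S] M') (st : Bool → Bool → S) (ex : X → X → S) (v : X) (w : List (Bool × X))
    (F : Bool → List (Bool × X) → M) :
    crossLine st ex v w (fun i r => φ (F i r)) = φ (crossLine st ex v w F) := by
  induction w generalizing F with
  | nil => rfl
  | cons s r ih => simp only [crossLine, ← map_smul, ← map_add, ih]

/-- Crossing preserves the number of vertical lines; in `latticeWord_scale` this fixes the power of
`δ` that each further line contributes. -/
theorem length_of_crossLine {M : Type*} [AddCommGroup M] [Module S M]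
    (st : Bool → Bool → S) (ex : X → X → S) (v : X) (w : List (Bool × X))
    {F G : Bool → List (Bool × X) → M} (h : ∀ i r, r.length = w.length → F i r = G i r) :
    crossLine st ex v w F = crossLine st ex v w G := by
  induction w generalizing F G with
  | nil => exact h _ _ rfl
  | cons s r ih =>
    refine ih fun i r' hr => ?_
    rw [h _ _ (by simp [hr]), h _ _ (by simp [hr])]

theorem latticeWord_scale (δ : S) (st : Bool → Bool → S) (ex : X → X → S) (t₂ t₃ : Bool → X → A)
    (v : List X) (w : List (Bool × X)) :
    latticeWord (fun i k => δ * st i k) (fun x y => δ * ex x y) t₂ t₃ v w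
      = δ ^ (w.length * v.length) • latticeWord st ex t₂ t₃ v w := by
  induction v generalizing w with
  | nil => simp [latticeWord]
  | cons x v ih =>
    simp only [latticeWord, crossLine_scale, List.length_cons, mul_add, mul_one, pow_add,
      mul_comm _ (δ ^ w.length), mul_smul]
    congr 1
    rw [← crossLine_smul]
    refine length_of_crossLine _ _ _ _ fun i r hr => ?_
    rw [ih, hr, mul_smul_comm]

variable {ε : S} {g : X → X → S} {t₂ t₃ : Bool → X → A}

/-- Without horizontal lines this is the commutation relation `ht` inside a product; each horizontal
line preserves it by `exchange_crossLine`. -/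
theorem exchange_latticeWord (hε : ε * ε = 1) {x y : X}
    (ht : ∀ k l, (1 - ε * g x y) • (t₂ k x * t₂ l y) + (ε * g x y) • (t₂ k y * t₂ l x)
      = bSign ε k l • (t₂ l y * t₂ k x)) (v : List X)
    (hrel : ∀ z ∈ v, g x y * (g z x - g z y) = g z x * g z y) :
    Exchange ε (g x y) x y (latticeWord (bSign ε) (fun a b => ε * g a b) t₂ t₃ v) := by
  induction v with
  | nil =>
    intro pre k l post
    have := congrArg (fun m => (pre.map fun s => t₂ s.1 s.2).prod * m
      * (post.map fun s => t₂ s.1 s.2).prod) (ht k l)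
    simp only [mul_add, add_mul, mul_smul_comm, smul_mul_assoc] at this
    simpa only [latticeWord, List.map_append, List.map_cons, List.prod_append, List.prod_cons,
      mul_assoc] using this
  | cons z v ih =>
    refine exchange_crossLine hε (hrel z (by simp)) _ fun i pre k l post => ?_
    have := congrArg (fun m => t₃ i z * m) (ih (fun z hz => hrel z (by simp [hz])) pre k l post)
    simpa only [mul_add, mul_smul_comm] using this

/-- The entering line carries `2` and first meets a `2`: straight passage and exchange give the same
state, and the line goes on with index `2`. -/
theorem crossLine_append_true {M : Type*} [AddCommGroup M] [Module S M] (z x : X)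
    (w : List (Bool × X)) (F : Bool → List (Bool × X) → M) :
    crossLine (bSign ε) (fun a b => ε * g a b) z (w ++ [(true, x)]) F
      = (1 + ε * g z x) •
        crossLine (bSign ε) (fun a b => ε * g a b) z w fun i r => F i (r ++ [(true, x)]) := by
  induction w generalizing F with
  | nil =>
    simp only [List.nil_append, crossLine, bSign, Bool.true_eq_false, false_and, if_false]
    module
  | cons s w ih => simp only [List.cons_append, crossLine, ih]

theorem latticeWord_append_true (x : X) (v : List X) (w : List (Bool × X)) :
    latticeWord (bSign ε) (fun a b => ε * g a b) t₂ t₃ v (w ++ [(true, x)])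
      = (v.map fun z => 1 + ε * g z x).prod •
        (latticeWord (bSign ε) (fun a b => ε * g a b) t₂ t₃ v w * t₂ true x) := by
  induction v generalizing w with
  | nil => simp [latticeWord]
  | cons z v ih =>
    simp only [latticeWord, crossLine_append_true, ih, List.map_cons, List.prod_cons, mul_smul,
      mul_smul_comm, crossLine_smul, ← mul_assoc]
    congr 2
    exact crossLine_map (LinearMap.mulRight S (t₂ true x)) _ _ _ _ _

/-- The recursion for the operator of a row of indices `1`, on a vector on which `t₂ true` acts by
scalars. -/
theorem latticeWord_recursion (hε : ε * ε = 1)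
    (hanti : ∀ x y, x ≠ y → g y x = -g x y)
    (hrel : ∀ v x y, v ≠ x → v ≠ y → x ≠ y → g x y * (g v x - g v y) = g v x * g v y)
    (ht : ∀ x y, x ≠ y → ∀ k l, (1 - ε * g x y) • (t₂ k x * t₂ l y)
      + (ε * g x y) • (t₂ k y * t₂ l x) = bSign ε k l • (t₂ l y * t₂ k x))
    {M : Type*} [AddCommGroup M] [Module S M] (φ : A →ₗ[S] M) (lam : X → S)
    (hφ : ∀ a b x, φ (a * (b * t₂ true x)) = lam x • φ (a * b))
    (u : List X) (z : X) (v : List X) (huv : (u ++ z :: v).Nodup) :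
    φ (latticeWord (bSign ε) (fun a b => ε * g a b) t₂ t₃ (z :: v) (ones u))
      = φ (t₃ true z * latticeWord (bSign ε) (fun a b => ε * g a b) t₂ t₃ v (ones u))
        + ∑ j : Fin u.length, (lam (u.get j) * (ε * g z (u.get j) * hopCoeff ε g u j
            * (v.map fun y => 1 + ε * g y (u.get j)).prod)) •
          φ (t₃ false z *
            latticeWord (bSign ε) (fun a b => ε * g a b) t₂ t₃ v (ones (u.eraseIdx j))) := by
  have hd := List.nodup_append.1 huv
  have hzv := List.nodup_cons.1 hd.2.1
  -- The row is sorted after applying `φ` and multiplying by `t₃ false z` on the left; the exchange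
  -- relations are linear and survive both operations.
  rw [latticeWord, crossLine_ones, map_add, map_hop, hop_eq_sum hanti hrel]
  · congr 1
    refine Finset.sum_congr rfl fun j _ => ?_
    rw [latticeWord_append_true, mul_smul_comm, map_smul, hφ]
    module
  · exact List.nodup_cons.2 ⟨fun h => hd.2.2 z h z (by simp) rfl, hd.1⟩
  · intro x hx y hy hxy pre k l post
    have := congrArg (fun m => φ (t₃ false z * m)) (exchange_latticeWord (t₃ := t₃) hε
      (ht x y hxy) v (fun a ha => hrel a x y (fun h => hd.2.2 x hx a (by simp [ha]) h.symm)
        (fun h => hd.2.2 y hy a (by simp [ha]) h.symm) hxy) pre k l post)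
    simpa only [mul_add, mul_smul_comm, map_add, map_smul] using this

end BetheWord

/-! ### Series in the spectral parameters -/

section Series

variable {N : ℕ} {p : Fin 3 → ZMod 2} {c : ℂ}

theorem scal_add (x y : Scal N) : scal p c (x + y) = scal p c x + scal p c y :=
  HahnSeries.map_add (algebraMap ℂ (Yangian p c)).toAddMonoidHom

theorem scal_mul (x y : Scal N) : scal p c (x * y) = scal p c x * scal p c y :=
  HahnSeries.map_mul (algebraMap ℂ (Yangian p c) : ℂ →ₙ+* Yangian p c)

theorem scal_single (e : Expo N) (a : ℂ) :
    scal p c (HahnSeries.single e a) = HahnSeries.single e (algebraMap ℂ _ a) :=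
  HahnSeries.map_single (algebraMap ℂ (Yangian p c)).toAddMonoidHom.toZeroHom

theorem scal_one : scal p c (1 : Scal N) = 1 := by
  rw [← HahnSeries.single_zero_one, scal_single, map_one, HahnSeries.single_zero_one]

theorem scal_zero : scal p c (0 : Scal N) = 0 :=
  HahnSeries.map_zero (algebraMap ℂ (Yangian p c)).toAddMonoidHom.toZeroHom

/-- The embedding of the scalars into the series over the super-Yangian. -/
def scalHom (N : ℕ) (p : Fin 3 → ZMod 2) (c : ℂ) : Scal N →+* YSeries N p c where
  toFun := scal p c
  map_one' := scal_one
  map_mul' := scal_mul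
  map_zero' := scal_zero
  map_add' := scal_add

theorem scal_comm (x : Scal N) (Y : YSeries N p c) : scal p c x * Y = Y * scal p c x := by
  ext e
  rw [HahnSeries.coeff_mul, HahnSeries.coeff_mul]
  refine Finset.sum_nbij' Prod.swap Prod.swap ?_ ?_ (fun _ _ => rfl) (fun _ _ => rfl) ?_
  · intro a ha
    simp only [Finset.mem_antidiagonal, Prod.fst_swap, Prod.snd_swap] at ha ⊢
    exact ⟨ha.2.1, ha.1, by rw [add_comm]; exact ha.2.2⟩
  · intro a ha
    simp only [Finset.mem_antidiagonal, Prod.fst_swap, Prod.snd_swap] at ha ⊢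
    exact ⟨ha.2.1, ha.1, by rw [add_comm]; exact ha.2.2⟩
  · intro a _
    exact Algebra.commutes _ _

instance instAlgebraScal : Algebra (Scal N) (YSeries N p c) :=
  (scalHom N p c).toAlgebra' scal_comm

theorem scal_smul_def (x : Scal N) (Y : YSeries N p c) : x • Y = scal p c x * Y := rfl

theorem grSeries_add (X Y : YSeries N p c) :
    grSeries p c (X + Y) = grSeries p c X + grSeries p c Y :=
  HahnSeries.map_add (gr p c : Yangian p c →+ Yangian p c)

theorem grSeries_mul (X Y : YSeries N p c) :
    grSeries p c (X * Y) = grSeries p c X * grSeries p c Y :=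
  HahnSeries.map_mul (gr p c : Yangian p c →ₙ+* Yangian p c)

theorem grSeries_scal (x : Scal N) : grSeries p c (scal p c x) = scal p c x := by
  ext e
  exact (gr p c).commutes _

/-- The grading automorphism of the series over the super-Yangian. -/
def grHom (N : ℕ) (p : Fin 3 → ZMod 2) (c : ℂ) : YSeries N p c →+* YSeries N p c where
  toFun := grSeries p c
  map_one' := by rw [← scal_one, grSeries_scal]
  map_mul' := grSeries_mul
  map_zero' := by rw [← scal_zero, grSeries_scal]
  map_add' := grSeries_add

theorem coeff_evalAt_invPow {R : Type*} [Semiring R] (k : Fin N) (F : PowerSeries R) (n : ℕ) :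
    (evalAt k F).coeff (invPow k n) = PowerSeries.coeff n F := by
  rw [evalAt, HahnSeries.embDomain_coeff, HahnSeries.coeff_toPowerSeries_symm]

theorem exists_of_coeff_evalAt_ne_zero {R : Type*} [Semiring R] {k : Fin N} {F : PowerSeries R}
    {e : Expo N} (h : (evalAt k F).coeff e ≠ 0) : ∃ n, e = invPow k n := by
  by_contra! hn
  exact h (HahnSeries.embDomain_of_notMem_range fun ⟨n, hn'⟩ => hn n hn'.symm)

theorem grSeries_monodromy (i j : Fin 3) (k : Fin N) :
    grSeries p c (monodromy p c i j k) = sgn (p i + p j) • monodromy p c i j k := by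
  ext e
  have hsm : (sgn (p i + p j) • monodromy p c i j k).coeff e
      = sgn (p i + p j) • (monodromy p c i j k).coeff e := rfl
  rw [hsm]
  change gr p c ((monodromy p c i j k).coeff e) = _
  by_cases h : ∃ n, e = invPow k n
  · obtain ⟨n, rfl⟩ := h
    rw [monodromy, coeff_evalAt_invPow, monodromySeries, PowerSeries.coeff_mk]
    have := congrArg (toYangian p c) (freeGr_coeff p c i j n)
    rw [map_zsmul] at this
    rw [← this]
    exact RingQuot.liftAlgHom_mkAlgHom_apply _ _ _ _
  · have : (monodromy p c i j k).coeff e = 0 := by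
      by_contra h'
      exact h (exists_of_coeff_evalAt_ne_zero h')
    rw [this, map_zero, smul_zero]

/-- The exponent of `x_k^{-r} x_l^{-s}`. -/
def expPair (k l : Fin N) (r s : ℤ) : Expo N := toLex (Pi.single k r + Pi.single l s)

theorem expPair_comm (k l : Fin N) (r s : ℤ) : expPair k l r s = expPair l k s r := by
  rw [expPair, add_comm, expPair]

theorem expPair_inj {k l : Fin N} (hkl : k ≠ l) {r s r' s' : ℤ}
    (h : expPair k l r s = expPair k l r' s') : r = r' ∧ s = s' := by
  have h' : (Pi.single k r + Pi.single l s : Fin N → ℤ) = Pi.single k r' + Pi.single l s' :=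
    toLex.injective h
  have h1 := congrFun h' k
  have h2 := congrFun h' l
  simp only [Pi.add_apply, Pi.single_eq_same, Pi.single_eq_of_ne hkl,
    Pi.single_eq_of_ne hkl.symm, add_zero, zero_add] at h1 h2
  exact ⟨h1, h2⟩

theorem invPow_add_invPow (k l : Fin N) (r s : ℕ) : invPow k r + invPow l s = expPair k l r s :=
  rfl

theorem coeff_evalAt_mul {R : Type*} [Semiring R] {k l : Fin N} (hkl : k ≠ l)
    (F G : PowerSeries R) (r s : ℤ) :
    (evalAt k F * evalAt l G).coeff (expPair k l r s)
      = if 0 ≤ r ∧ 0 ≤ s then PowerSeries.coeff r.toNat F * PowerSeries.coeff s.toNat G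
        else 0 := by
  rw [HahnSeries.coeff_mul]
  split_ifs with h
  · obtain ⟨r, rfl⟩ := Int.eq_ofNat_of_zero_le h.1
    obtain ⟨s, rfl⟩ := Int.eq_ofNat_of_zero_le h.2
    rw [Finset.sum_eq_single (invPow k r, invPow l s)]
    · rw [coeff_evalAt_invPow, coeff_evalAt_invPow]; rfl
    · rintro ⟨a, b⟩ hab hne
      rw [Finset.mem_antidiagonal] at hab
      obtain ⟨r', rfl⟩ := exists_of_coeff_evalAt_ne_zero hab.1
      obtain ⟨s', rfl⟩ := exists_of_coeff_evalAt_ne_zero hab.2.1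
      have := expPair_inj hkl ((invPow_add_invPow k l r' s').symm.trans hab.2.2)
      refine absurd ?_ hne
      rw [Int.ofNat_inj.1 this.1, Int.ofNat_inj.1 this.2]
    · intro hn
      rw [Finset.mem_antidiagonal] at hn
      by_contra hne
      refine hn ⟨fun h0 => hne ?_, fun h0 => hne ?_, rfl⟩
      · simp only [h0, zero_mul]
      · simp only [h0, mul_zero]
  · refine Finset.sum_eq_zero ?_
    rintro ⟨a, b⟩ hab
    rw [Finset.mem_antidiagonal] at hab
    obtain ⟨r', rfl⟩ := exists_of_coeff_evalAt_ne_zero hab.1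
    obtain ⟨s', rfl⟩ := exists_of_coeff_evalAt_ne_zero hab.2.1
    have := expPair_inj hkl ((invPow_add_invPow k l r' s').symm.trans hab.2.2)
    exact absurd ⟨by omega, by omega⟩ h

theorem coeff_evalAt_mul_of_ne {R : Type*} [Semiring R] {k l : Fin N}
    (F G : PowerSeries R) {e : Expo N} (he : ∀ r s : ℤ, e ≠ expPair k l r s) :
    (evalAt k F * evalAt l G).coeff e = 0 := by
  rw [HahnSeries.coeff_mul]
  refine Finset.sum_eq_zero ?_
  rintro ⟨a, b⟩ hab
  rw [Finset.mem_antidiagonal] at hab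
  obtain ⟨r', rfl⟩ := exists_of_coeff_evalAt_ne_zero hab.1
  obtain ⟨s', rfl⟩ := exists_of_coeff_evalAt_ne_zero hab.2.1
  exact absurd hab.2.2.symm (he r' s')

theorem coeff_scal_par_mul (k : Fin N) (X : YSeries N p c) (e : Expo N) :
    (scal p c (par k) * X).coeff e = X.coeff (e + toLex (Pi.single k 1)) := by
  rw [par, scal_single, map_one, HahnSeries.coeff_single_mul, one_mul]
  congr 1
  rw [sub_eq_add_neg]
  congr 1
  rw [← toLex_neg, ← Pi.single_neg, neg_neg]

theorem toYangian_rtt (i j k l : Fin 3) (r s : ℕ) :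
    toYangian p c (freeComm p c i j k l (r + 1) s) - toYangian p c (freeComm p c i j k l r (s + 1))
      = sgn (p l * (p i + p j) + p i * p j) • c • (toYangian p c (freeCoeff c i l r)
        * toYangian p c (freeCoeff c k j s) - toYangian p c (freeCoeff c i l s)
        * toYangian p c (freeCoeff c k j r)) := by
  have h : toYangian p c _ = toYangian p c _ :=
    RingQuot.mkAlgHom_rel ℂ (Rel.rtt (p := p) (c := c) i j k l r s)
  simpa only [map_sub, map_zsmul, map_smul, map_mul] using h

theorem freeComm_zero_left (i j k l : Fin 3) (s : ℕ) : freeComm p c i j k l 0 s = 0 := by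
  have h2 : ∀ x : ZMod 2, x + x = 0 := by decide
  by_cases h : i = j
  · subst h; simp [freeComm, freeCoeff, h2, sgn]
  · simp [freeComm, freeCoeff, h]

theorem freeComm_zero_right (i j k l : Fin 3) (r : ℕ) : freeComm p c i j k l r 0 = 0 := by
  have h2 : ∀ x : ZMod 2, x + x = 0 := by decide
  by_cases h : k = l
  · subst h; simp [freeComm, freeCoeff, h2, sgn]
  · simp [freeComm, freeCoeff, h]

theorem coeff_monodromy_mul {k l : Fin N} (hkl : k ≠ l) (i j i' j' : Fin 3) (r s : ℤ) :
    (monodromy p c i j k * monodromy p c i' j' l).coeff (expPair k l r s)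
      = if 0 ≤ r ∧ 0 ≤ s then toYangian p c (freeCoeff c i j r.toNat)
        * toYangian p c (freeCoeff c i' j' s.toNat) else 0 := by
  rw [monodromy, monodromy, coeff_evalAt_mul hkl]
  simp only [monodromySeries, PowerSeries.coeff_mk]

/-- The defining relations are imposed on modes with `r, s ≥ 0`. Multiplication by a parameter
shifts exponents by one, so the coefficients at exponent `-1` must be checked as well; they vanish
because the leading coefficient of `T_ij(u)` is the scalar `δ_ij`. -/
theorem monodromy_comm_mul {x y : Fin N} (hxy : x ≠ y) (i j k l : Fin 3) :
    scal p c (par x - par y) * (monodromy p c i j x * monodromy p c k l y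
        - sgn ((p i + p j) * (p k + p l)) • (monodromy p c k l y * monodromy p c i j x))
      = scal p c (HahnSeries.C c) * sgn (p l * (p i + p j) + p i * p j) •
        (monodromy p c i l x * monodromy p c k j y - monodromy p c i l y * monodromy p c k j x) := by
  have zs : ∀ (n : ℤ) (X : YSeries N p c) (e : Expo N), (n • X).coeff e = n • X.coeff e :=
    fun _ _ _ => rfl
  have hC : ∀ (X : YSeries N p c) (e : Expo N),
      (scal p c (HahnSeries.C c) * X).coeff e = c • X.coeff e := by
    intro X e
    rw [HahnSeries.C_apply, scal_single, HahnSeries.coeff_single_zero_mul, Algebra.smul_def]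
  have hsub : scal p c (par x - par y) = scal p c (par x) - scal p c (par y) :=
    map_sub (scalHom N p c) _ _
  ext e
  rw [hsub, sub_mul, HahnSeries.coeff_sub, coeff_scal_par_mul, coeff_scal_par_mul, hC, zs]
  simp only [HahnSeries.coeff_sub, zs]
  by_cases he : ∃ r s : ℤ, e = expPair x y r s
  · obtain ⟨r, s, rfl⟩ := he
    have ex : expPair x y r s + toLex (Pi.single x 1) = expPair x y (r + 1) s := by
      rw [expPair, expPair, Pi.single_add, add_right_comm]; rfl
    have ey : expPair x y r s + toLex (Pi.single y 1) = expPair x y r (s + 1) := by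
      rw [expPair, expPair, Pi.single_add, ← add_assoc]; rfl
    rw [ex, ey]
    simp only [coeff_monodromy_mul hxy]
    simp only [expPair_comm x y, coeff_monodromy_mul hxy.symm]
    have key : ∀ r s : ℤ, ((if 0 ≤ r ∧ 0 ≤ s then toYangian p c (freeCoeff c i j r.toNat)
        * toYangian p c (freeCoeff c k l s.toNat) else 0)
        - sgn ((p i + p j) * (p k + p l)) • if 0 ≤ s ∧ 0 ≤ r then
          toYangian p c (freeCoeff c k l s.toNat) * toYangian p c (freeCoeff c i j r.toNat) else 0)
        = if 0 ≤ r ∧ 0 ≤ s then toYangian p c (freeComm p c i j k l r.toNat s.toNat) else 0 := by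
      intro r s
      simp only [and_comm (a := 0 ≤ s)]
      split_ifs
      · rw [freeComm, map_sub, map_zsmul, map_mul, map_mul]
      · simp
    rw [key, key]
    by_cases hr : 0 ≤ r
    · obtain ⟨r, rfl⟩ := Int.eq_ofNat_of_zero_le hr
      by_cases hs : 0 ≤ s
      · obtain ⟨s, rfl⟩ := Int.eq_ofNat_of_zero_le hs
        have := toYangian_rtt (p := p) (c := c) i j k l r s
        have n1 : ((r : ℤ) + 1).toNat = r + 1 := by omega
        have n2 : ((s : ℤ) + 1).toNat = s + 1 := by omega
        rw [if_pos (by omega), if_pos (by omega), if_pos (by omega), if_pos (by omega), n1, n2,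
          Int.toNat_natCast, Int.toNat_natCast, this, smul_comm]
      · rw [if_neg (c := 0 ≤ (r : ℤ) + 1 ∧ 0 ≤ s) (by omega),
          if_neg (c := 0 ≤ (r : ℤ) ∧ 0 ≤ s) (by omega),
          if_neg (c := 0 ≤ s ∧ 0 ≤ (r : ℤ)) (by omega)]
        -- The boundary exponent `s = -1`: the shifted term involves only the leading coefficient,
        -- whose graded commutator vanishes.
        by_cases hs' : s + 1 = 0
        · rw [hs', if_pos (by omega), Int.toNat_zero, freeComm_zero_right]
          simp
        · rw [if_neg (by omega)]
          simp
    · rw [if_neg (c := 0 ≤ r ∧ 0 ≤ s + 1) (by omega), if_neg (c := 0 ≤ r ∧ 0 ≤ s) (by omega),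
        if_neg (c := 0 ≤ s ∧ 0 ≤ r) (by omega)]
      -- The same boundary case in the first variable.
      by_cases hr' : r + 1 = 0
      · rw [hr', Int.toNat_zero, freeComm_zero_left]
        simp
      · rw [if_neg (by omega)]
        simp
  · push Not at he
    have ex : ∀ r s, e + toLex (Pi.single x 1) ≠ expPair x y r s := by
      intro r s h
      refine he (r - 1) s ?_
      rw [eq_sub_of_add_eq h, expPair, expPair, Pi.single_sub, sub_add_eq_add_sub, toLex_sub]
    have ey : ∀ r s, e + toLex (Pi.single y 1) ≠ expPair x y r s := by
      intro r s h
      refine he r (s - 1) ?_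
      rw [eq_sub_of_add_eq h, expPair, expPair, Pi.single_sub, ← add_sub_assoc, toLex_sub]
    have flip : ∀ {e : Expo N}, (∀ r s, e ≠ expPair x y r s) → ∀ r s, e ≠ expPair y x r s :=
      fun h r s => by rw [expPair_comm]; exact h s r
    simp only [monodromy, coeff_evalAt_mul_of_ne _ _ ex, coeff_evalAt_mul_of_ne _ _ ey,
      coeff_evalAt_mul_of_ne _ _ he, coeff_evalAt_mul_of_ne _ _ (flip ex),
      coeff_evalAt_mul_of_ne _ _ (flip ey), coeff_evalAt_mul_of_ne _ _ (flip he)]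
    simp

theorem coeff_par (x : Fin N) (n : ℤ) (y : Fin N) (hn : n ≠ 0) :
    (par x : Scal N).coeff (toLex (Pi.single y n)) = if y = x ∧ n = -1 then 1 else 0 := by
  rw [par, HahnSeries.coeff_single]
  congr 1
  rw [eq_iff_iff]
  constructor
  · intro h
    have h' : (Pi.single y n : Fin N → ℤ) = Pi.single x (-1) := toLex.injective h
    have := congrFun h' y
    rw [Pi.single_eq_same] at this
    by_cases hxy : y = x
    · subst hxy; simpa using this
    · rw [Pi.single_eq_of_ne hxy] at this
      exact absurd this hn
  · rintro ⟨rfl, rfl⟩; rfl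

theorem par_sub_par_add_ne_zero {x y : Fin N} (hxy : x ≠ y) (a : ℂ) :
    (par x - par y + HahnSeries.C a : Scal N) ≠ 0 := by
  intro h
  -- The coefficient of the monomial `x` itself is `1`: neither `y` nor the constant contributes to
  -- it.
  have := congrArg (fun X : Scal N => X.coeff (toLex (Pi.single x (-1)))) h
  simp only [HahnSeries.coeff_add, HahnSeries.coeff_sub, coeff_par _ _ _ (by decide : (-1:ℤ) ≠ 0),
    HahnSeries.coeff_zero] at this
  rw [HahnSeries.C_apply, HahnSeries.coeff_single_of_ne] at this
  · simp [hxy] at this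
  · intro h0
    have h' : (Pi.single x (-1) : Fin N → ℤ) = 0 := toLex.injective h0
    simpa using congrFun h' x

theorem par_sub_par_ne_zero {x y : Fin N} (hxy : x ≠ y) : (par x - par y : Scal N) ≠ 0 := by
  simpa using par_sub_par_add_ne_zero hxy 0

theorem div_sub_swap {K : Type*} [Field K] (a x y : K) : a / (y - x) = -(a / (x - y)) := by
  rw [← neg_sub x y, div_neg]

theorem gFun_anti (x y : Fin N) : gFun c y x = -gFun c x y :=
  div_sub_swap _ _ _

theorem gFun_rel {v x y : Fin N} (hvx : v ≠ x) (hvy : v ≠ y) (hxy : x ≠ y) :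
    gFun c x y * (gFun c v x - gFun c v y) = gFun c v x * gFun c v y := by
  have h1 := par_sub_par_ne_zero hvx
  have h2 := par_sub_par_ne_zero hvy
  have h3 := par_sub_par_ne_zero hxy
  simp only [gFun]
  field_simp
  ring

theorem fFun_ne_zero {x y : Fin N} (hxy : x ≠ y) : fFun c x y ≠ 0 := by
  have h := par_sub_par_ne_zero hxy
  have h' := par_sub_par_add_ne_zero hxy c
  rw [fFun, gFun, one_add_div h]
  exact div_ne_zero h' h

/-- The exchange relations of the entries of the monodromy matrix. -/
theorem monodromy_comm {x y : Fin N} (hxy : x ≠ y) (i j k l : Fin 3) :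
    monodromy p c i j x * monodromy p c k l y
        - sgn ((p i + p j) * (p k + p l)) • (monodromy p c k l y * monodromy p c i j x)
      = sgn (p l * (p i + p j) + p i * p j) • gFun c x y •
        (monodromy p c i l x * monodromy p c k j y
          - monodromy p c i l y * monodromy p c k j x) := by
  have h := congrArg (fun X => scal p c (par x - par y)⁻¹ * X) (monodromy_comm_mul hxy i j k l)
  simp only [← mul_assoc, ← scal_mul, inv_mul_cancel₀ (par_sub_par_ne_zero hxy), scal_one,
    one_mul] at h
  rw [h, gFun, smul_comm, scal_smul_def, div_eq_inv_mul]

end Series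

/-! ### From the graded tensor product to matrices -/

theorem sgn_zero : sgn 0 = 1 := rfl

theorem sgn_smul_sgn_smul {M : Type*} [AddCommGroup M] (x y : ZMod 2) (m : M) :
    sgn x • sgn y • m = sgn (x + y) • m := by
  rw [smul_smul, sgn_mul_sgn]

theorem sgn_smul_mul_sgn_smul {B : Type*} [Ring B] (x y : ZMod 2) (a b : B) :
    (sgn x • a) * (sgn y • b) = sgn (x + y) • (a * b) := by
  rw [smul_mul_smul_comm, sgn_mul_sgn]

/-! ### Degrees of basis vectors, under changes of one index and under transpositions -/

section Weights

variable {n : ℕ} (π : Fin 3 → ZMod 2)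

/-- The degree of the basis vector `e_I`. -/
def wt (I : Fin n → Fin 3) : ZMod 2 := ∑ s, π (I s)

/-- The degree of the part of the basis vector `e_I` at the sites before `k`. -/
def pre (I : Fin n → Fin 3) (k : Fin n) : ZMod 2 := ∑ r ∈ Finset.Iio k, π (I r)

variable {π}

theorem wt_eq_pre_add (I : Fin n → Fin 3) (k : Fin n) :
    wt π I = pre π I k + π (I k) + ∑ r ∈ Finset.Ioi k, π (I r) := by
  have h : (Finset.univ : Finset (Fin n)) = (Finset.Iio k).disjUnion (Finset.Ici k)
      (Finset.disjoint_left.2 fun x hx hx' => by simp at hx hx'; omega) := by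
    ext x; simp [lt_or_ge]
  rw [wt, h, Finset.sum_disjUnion, ← Finset.Ioi_insert, Finset.sum_insert (by simp), pre, add_assoc]

theorem pre_congr {I J : Fin n → Fin 3} {k : Fin n} (h : ∀ r < k, I r = J r) :
    pre π I k = pre π J k :=
  Finset.sum_congr rfl fun r hr => by rw [h r (Finset.mem_Iio.1 hr)]

theorem ZMod2.add_self (x : ZMod 2) : x + x = 0 := by revert x; decide

theorem pre_update (I : Fin n → Fin 3) (t k : Fin n) (m : Fin 3) :
    pre π (Function.update I t m) k = pre π I k + if t < k then π (I t) + π m else 0 := by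
  split_ifs with h
  · have ht : t ∈ Finset.Iio k := Finset.mem_Iio.2 h
    have : ∑ r ∈ (Finset.Iio k).erase t, π (Function.update I t m r)
        = ∑ r ∈ (Finset.Iio k).erase t, π (I r) :=
      Finset.sum_congr rfl fun r hr => by rw [Function.update_of_ne (Finset.ne_of_mem_erase hr)]
    rw [pre, pre, ← Finset.add_sum_erase _ _ ht, ← Finset.add_sum_erase _ (fun r => π (I r)) ht,
      this, Function.update_self]
    linear_combination -ZMod2.add_self (π (I t))
  · rw [add_zero]
    exact pre_congr fun r hr => Function.update_of_ne (by rintro rfl; exact h hr) _ _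

theorem eq_update_of_agree {I L : Fin n → Fin 3} {s : Fin n} (h : ∀ r, r ≠ s → I r = L r) :
    L = Function.update I s (L s) := by
  funext r
  by_cases hr : r = s
  · subst hr; rw [Function.update_self]
  · rw [Function.update_of_ne hr, h r hr]

theorem pre_eq_of_agree {I L : Fin n → Fin 3} {s : Fin n} (h : ∀ r, r ≠ s → I r = L r)
    (k : Fin n) : pre π L k = pre π I k + if s < k then π (I s) + π (L s) else 0 := by
  conv_lhs => rw [eq_update_of_agree h]
  rw [pre_update]

theorem swap_eq_update {s t : Fin n} (I : Fin n → Fin 3) :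
    I ∘ Equiv.swap s t = Function.update (Function.update I s (I t)) t (I s) := by
  funext r
  by_cases hr : r = t
  · subst hr; simp
  · by_cases hr' : r = s
    · subst hr'; simp [hr]
    · simp [hr, hr', Equiv.swap_apply_of_ne_of_ne hr' hr]

theorem pre_swap {s t : Fin n} (hts : t < s) (I : Fin n → Fin 3) (k : Fin n) :
    pre π (I ∘ Equiv.swap s t) k
      = pre π I k + if t < k ∧ k ≤ s then π (I s) + π (I t) else 0 := by
  rw [swap_eq_update, pre_update, pre_update, Function.update_of_ne hts.ne]
  have h := ZMod2.add_self (π (I s) + π (I t))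
  by_cases h1 : s < k
  · rw [if_pos h1, if_pos (hts.trans h1), if_neg (by omega)]
    linear_combination h
  · rw [if_neg h1]
    by_cases h2 : t < k
    · rw [if_pos h2, if_pos ⟨h2, by omega⟩]
      ring
    · rw [if_neg h2, if_neg (by omega)]
      ring

theorem sum_agree_eq_sum_update {M : Type*} [AddCommMonoid M] (I : Fin n → Fin 3) (s : Fin n)
    (f : (Fin n → Fin 3) → M) :
    (∑ K, if ∀ r, r ≠ s → I r = K r then f K else 0) = ∑ m, f (Function.update I s m) := by
  rw [← Finset.sum_filter]
  refine Finset.sum_nbij' (fun K => K s) (fun m => Function.update I s m) ?_ ?_ ?_ ?_ ?_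
  · simp
  · intro m _
    rw [Finset.mem_filter]
    exact ⟨Finset.mem_univ _, fun r hr => (Function.update_of_ne hr _ _).symm⟩
  · intro K hK
    exact (eq_update_of_agree (Finset.mem_filter.1 hK).2).symm
  · simp
  · intro K hK
    rw [← eq_update_of_agree (Finset.mem_filter.1 hK).2]

end Weights

/-! ### The twist from graded multiplication to matrix multiplication -/

section Hat

variable {n : ℕ} {B : Type*} [Ring B]

/-- The sign relating the coefficients in the graded tensor product to matrix entries. -/
def hatSign (π : Fin 3 → ZMod 2) (I J : Fin n → Fin 3) : ZMod 2 :=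
  ∑ s, ∑ r ∈ Finset.Ioi s, π (I r) * (π (I s) + π (J s)) + (wt π I + wt π J) * wt π J

/-- The matrix attached to an element of the graded tensor product. -/
def hat (π : Fin 3 → ZMod 2) (X : Aux n B) : Matrix (Fin n → Fin 3) (Fin n → Fin 3) B :=
  Matrix.of fun I J => sgn (hatSign π I J) • X I J

/-- An element of even degree of the graded tensor product. -/
def IsEven (p : Fin 3 → ZMod 2) (γ : B → B) (X : Aux n B) : Prop :=
  ∀ I J, γ (X I J) = sgn (wt p I + wt p J) • X I J

variable {p π : Fin 3 → ZMod 2} {γ : B → B}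

theorem hatSign_self (I : Fin n → Fin 3) : hatSign π I I = 0 := by
  simp [hatSign, ZMod2.add_self]

/-- A coboundary identity: the sign from reordering matrix units, together with the sign from
passing them through an even element's coefficient, is the coboundary of `hatSign`. -/
theorem hatSign_add (I J L : Fin n → Fin 3) :
    hatSign π I L + ∑ s, ∑ r ∈ Finset.Ioi s, (π (I r) + π (J r)) * (π (J s) + π (L s))
      + (wt π I + wt π J) * (wt π J + wt π L) = hatSign π I J + hatSign π J L := by
  have h : ∑ s, ∑ r ∈ Finset.Ioi s, π (I r) * (π (I s) + π (L s))
      + ∑ s, ∑ r ∈ Finset.Ioi s, (π (I r) + π (J r)) * (π (J s) + π (L s))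
      = ∑ s, ∑ r ∈ Finset.Ioi s, π (I r) * (π (I s) + π (J s))
      + ∑ s, ∑ r ∈ Finset.Ioi s, π (J r) * (π (J s) + π (L s)) := by
    rw [← Finset.sum_add_distrib, ← Finset.sum_add_distrib]
    refine Finset.sum_congr rfl fun s _ => ?_
    rw [← Finset.sum_add_distrib, ← Finset.sum_add_distrib]
    refine Finset.sum_congr rfl fun r _ => ?_
    generalize π (I r) = a, π (I s) = b, π (L s) = c, π (J r) = d, π (J s) = e
    revert a b c d e
    decide
  have h2 : ∀ x y z : ZMod 2, (x + z) * z + (x + y) * (y + z) = (x + y) * y + (y + z) * z := by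
    decide
  simp only [hatSign]
  linear_combination h + h2 (wt π I) (wt π J) (wt π L)

theorem wt_add_wt (hπ : ∀ i j, p i + p j = π i + π j) (I J : Fin n → Fin 3) :
    wt p I + wt p J = wt π I + wt π J := by
  simp only [wt, ← Finset.sum_add_distrib, hπ]

/-- Evenness of the left factor makes `γ` act on `X I J` by the sign of its matrix unit, so every
sign depends on indices only and `hatSign_add` applies. Only differences of degrees occur, which is
why `p` may be replaced by `π`. No parity of `Y` is needed, so the odd elements `E_21`, `E_32` can
stay on the right. -/
theorem hat_auxMul (hπ : ∀ i j, p i + p j = π i + π j) {X : Aux n B} (hX : IsEven p γ X)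
    (Y : Aux n B) : hat π (auxMul p γ X Y) = hat π X * hat π Y := by
  ext I L
  rw [Matrix.mul_apply]
  simp only [hat, Matrix.of_apply, auxMul, Finset.smul_sum]
  refine Finset.sum_congr rfl fun J _ => ?_
  have h1 : (if ∑ s, (p (J s) + p (L s)) = 0 then X I J else γ (X I J))
      = sgn ((wt π I + wt π J) * (wt π J + wt π L)) • X I J := by
    have e : ∑ s, (p (J s) + p (L s)) = wt π J + wt π L := by
      rw [Finset.sum_add_distrib]; exact wt_add_wt hπ J L
    rw [e, hX, wt_add_wt hπ]
    have h01 : ∀ x : ZMod 2, x = 0 ∨ x = 1 := by decide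
    rcases h01 (wt π J + wt π L) with h | h
    · rw [h, if_pos rfl, mul_zero, sgn_zero, one_smul]
    · rw [h, if_neg one_ne_zero, mul_one]
  rw [h1, smul_mul_assoc, sgn_smul_sgn_smul, sgn_smul_sgn_smul, sgn_smul_mul_sgn_smul,
    ← hatSign_add]
  simp only [hπ, add_assoc]

theorem hat_auxProd_append (hπ : ∀ i j, p i + p j = π i + π j) (l l' : List (Aux n B))
    (hl : ∀ X ∈ l, IsEven p γ X) :
    hat π (auxProd p γ (l ++ l')) = (l.map (hat π)).prod * hat π (auxProd p γ l') := by
  induction l with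
  | nil => simp
  | cons X l ih =>
    have : auxProd p γ (X :: l ++ l') = auxMul p γ X (auxProd p γ (l ++ l')) := rfl
    rw [this, hat_auxMul hπ (hl X (by simp)), ih fun Y hY => hl Y (by simp [hY]), List.map_cons,
      List.prod_cons, mul_assoc]

theorem hat_apply_self (X : Aux n B) (I : Fin n → Fin 3) : hat π X I I = X I I := by
  rw [hat, Matrix.of_apply, hatSign_self, sgn_zero, one_smul]

/-- The matrix of `∑_ij E_ij^{(s)} ⊗ M_ij`. -/
def siteOp (π : Fin 3 → ZMod 2) (s : Fin n) (M : Fin 3 → Fin 3 → B) :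
    Matrix (Fin n → Fin 3) (Fin n → Fin 3) B :=
  Matrix.of fun I J => if ∀ r, r ≠ s → I r = J r then
    sgn ((π (I s) + π (J s)) * (π (J s) + pre π I s)) • M (I s) (J s) else 0

theorem hat_atSite (s : Fin n) (M : Fin 3 → Fin 3 → B) : hat π (atSite s M) = siteOp π s M := by
  ext I J
  simp only [hat, siteOp, atSite, Matrix.of_apply]
  split_ifs with h
  · congr 2
    have e1 : ∑ x, ∑ r ∈ Finset.Ioi x, π (I r) * (π (I x) + π (J x))
        = ∑ r ∈ Finset.Ioi s, π (I r) * (π (I s) + π (J s)) := by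
      refine Finset.sum_eq_single s (fun x _ hx => Finset.sum_eq_zero fun r _ => ?_) (by simp)
      rw [h x hx, ZMod2.add_self, mul_zero]
    have e2 : ∑ r ∈ Finset.Ioi s, π (I r) = ∑ r ∈ Finset.Ioi s, π (J r) :=
      Finset.sum_congr rfl fun r hr => by rw [h r (Finset.mem_Ioi.1 hr).ne']
    have e3 : pre π J s = pre π I s := pre_congr fun r hr => (h r hr.ne).symm
    rw [hatSign, e1, ← Finset.sum_mul, wt_eq_pre_add I s, wt_eq_pre_add J s, e2, e3]
    generalize ∑ r ∈ Finset.Ioi s, π (J r) = a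
    generalize pre π I s = b, π (I s) = c, π (J s) = d
    revert a b c d
    decide
  · rw [smul_zero]

theorem siteOp_mul_apply (s : Fin n) (M : Fin 3 → Fin 3 → B)
    (Y : Matrix (Fin n → Fin 3) (Fin n → Fin 3) B) (I L : Fin n → Fin 3) :
    (siteOp π s M * Y) I L = ∑ m, sgn ((π (I s) + π m) * (π m + pre π I s)) •
      (M (I s) m * Y (Function.update I s m) L) := by
  rw [Matrix.mul_apply]
  simp only [siteOp, Matrix.of_apply, ite_mul, zero_mul]
  rw [sum_agree_eq_sum_update]
  simp only [Function.update_self, smul_mul_assoc]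

theorem isEven_atSite {s : Fin n} {M : Fin 3 → Fin 3 → B} (h0 : γ 0 = 0)
    (hM : ∀ i j, γ (M i j) = sgn (p i + p j) • M i j) : IsEven p γ (atSite s M) := by
  intro I J
  rw [atSite]
  split_ifs with h
  · rw [hM]
    congr 2
    rw [wt, wt, ← Finset.sum_add_distrib, Finset.sum_eq_single s _ (by simp)]
    intro r _ hr
    rw [h r hr, ZMod2.add_self]
  · rw [h0, smul_zero]

theorem elemAt_mul (h0 : γ 0 = 0) (h1 : γ 1 = 1) (s : Fin n) (i j : Fin 3) (Y : Aux n B)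
    (I L : Fin n → Fin 3) :
    auxMul p γ (elemAt B s i j) Y I L = if I s = i then
      sgn ((p i + p j) * ∑ r ∈ Finset.Iio s, (p (I r) + p (L r))) •
        Y (Function.update I s j) L else 0 := by
  have hγ : ∀ (q : Prop) [Decidable q] (K : Fin n → Fin 3), (if q then elemAt B s i j I K
      else γ (elemAt B s i j I K)) = elemAt B s i j I K := by
    intro q _ K
    have : γ (elemAt B s i j I K) = elemAt B s i j I K := by
      simp only [elemAt, atSite]
      split_ifs <;> simp [h0, h1]
    simp [this]
  have e : ∀ K, sgn (∑ x, ∑ r ∈ Finset.Ioi x, (p (I r) + p (K r)) * (p (K x) + p (L x))) •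
      (elemAt B s i j I K * Y K L) = if ∀ r, r ≠ s → I r = K r then
        (if I s = i ∧ K s = j then sgn ((p i + p j) * ∑ r ∈ Finset.Iio s, (p (I r) + p (L r))) •
          Y K L else 0) else 0 := by
    intro K
    simp only [elemAt, atSite]
    split_ifs with h h'
    · rw [one_mul, ← h'.1, ← h'.2]
      congr 2
      -- `I` and `K` differ only at `s`; once the larger site is summed outermost, only its value
      -- `s` contributes.
      rw [Finset.sum_comm' (t' := Finset.univ) (s' := fun r => Finset.Iio r) (by simp)]
      rw [Finset.sum_eq_single s _ (by simp), ← Finset.mul_sum]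
      · congr 1
        exact Finset.sum_congr rfl fun r hr => by rw [h r (Finset.mem_Iio.1 hr).ne]
      · intro r _ hr
        rw [h r hr]
        simp [ZMod2.add_self]
    · simp
    · simp
  simp only [auxMul, hγ, e]
  rw [sum_agree_eq_sum_update]
  simp only [Function.update_self]
  by_cases hi : I s = i
  · simp [hi]
  · simp [hi]

/-- The sign of the graded permutation of two sites. -/
def swapSign (π : Fin 3 → ZMod 2) (s t : Fin n) (I : Fin n → Fin 3) : ZMod 2 :=
  (π (I s) + π (I t)) * (pre π I s + pre π I t) + π (I t)

/-- The matrix of the graded permutation of the sites `s` and `t`, where `t < s`. -/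
def swapOp (B : Type*) [Ring B] (π : Fin 3 → ZMod 2) (s t : Fin n) :
    Matrix (Fin n → Fin 3) (Fin n → Fin 3) B :=
  Matrix.of fun I J => if J = I ∘ Equiv.swap s t then sgn (swapSign π s t I) • 1 else 0

end Hat

/-! ### The graded permutation, the `R`-matrix and the RTT relation -/

section RMatrix

variable {n : ℕ} {B : Type*} [Ring B] {p π : Fin 3 → ZMod 2} {s t : Fin n}

theorem swap_swap_comp (I : Fin n → Fin 3) : (I ∘ Equiv.swap s t) ∘ Equiv.swap s t = I := by
  funext r; simp

theorem eq_comp_swap_iff {I J : Fin n → Fin 3} :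
    J = I ∘ Equiv.swap s t ↔ I = J ∘ Equiv.swap s t := by
  constructor <;> (rintro rfl; rw [swap_swap_comp])

theorem wt_swap (I : Fin n → Fin 3) : wt π (I ∘ Equiv.swap s t) = wt π I :=
  Equiv.sum_comp (Equiv.swap s t) fun r => π (I r)

theorem swapSign_swap (hts : t < s) (I : Fin n → Fin 3) :
    swapSign π s t (I ∘ Equiv.swap s t) = swapSign π s t I := by
  rw [swapSign, swapSign, pre_swap hts, pre_swap hts, if_pos ⟨hts, le_rfl⟩, if_neg (by simp)]
  simp only [Function.comp_apply, Equiv.swap_apply_left, Equiv.swap_apply_right]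
  generalize π (I s) = a, π (I t) = b, pre π I s = c, pre π I t = d
  revert a b c d
  decide

theorem permOp_apply {γ : B → B} (h0 : γ 0 = 0) (h1 : γ 1 = 1) (hts : t < s)
    (I J : Fin n → Fin 3) :
    permOp B p γ s t I J = if J = I ∘ Equiv.swap s t then sgn (p (I s)) • 1 else 0 := by
  have e : permOp B p γ s t I J
      = ∑ i, ∑ j, sgn (p j) • auxMul p γ (elemAt B s i j) (elemAt B t j i) I J := by
    simp only [permOp, Finset.sum_apply, Pi.smul_apply]
  rw [e, Finset.sum_eq_single (I s), Finset.sum_eq_single (I t)]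
  · rw [elemAt_mul h0 h1, if_pos rfl]
    simp only [elemAt, atSite, Function.update_of_ne hts.ne, true_and]
    by_cases hJ : J = I ∘ Equiv.swap s t
    · have hJt : J t = I s := by rw [hJ]; simp
      have h : ∀ r, r ≠ t → Function.update I s (I t) r = J r := fun r hr => by
        rw [hJ, swap_eq_update, Function.update_of_ne hr]
      have h' : ∀ r ∈ Finset.Iio s, r ≠ t → p (I r) + p (J r) = 0 := by
        intro r hr hrt
        rw [← h r hrt, Function.update_of_ne (Finset.mem_Iio.1 hr).ne, ZMod2.add_self]
      rw [if_pos h, if_pos hJ, if_pos hJt,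
        Finset.sum_eq_single t h' (by simp [hts]), hJt, sgn_smul_sgn_smul]
      congr 2
      generalize p (I s) = a, p (I t) = b
      revert a b
      decide
    · rw [if_neg hJ]
      split_ifs with h h'
      · refine absurd ?_ hJ
        rw [swap_eq_update, eq_update_of_agree h, h']
      · simp
      · simp
  · intro j _ hj
    rw [elemAt_mul h0 h1, if_pos rfl]
    simp only [elemAt, atSite, Function.update_of_ne hts.ne, hj.symm, false_and, if_false, ite_self,
      smul_zero]
  · simp
  · intro i _ hi
    refine Finset.sum_eq_zero fun j _ => ?_
    rw [elemAt_mul h0 h1, if_neg hi.symm, smul_zero]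
  · simp

theorem hatSign_swap (hts : t < s) (I : Fin n → Fin 3) :
    hatSign π I (I ∘ Equiv.swap s t) = swapSign π s t I + π (I s) := by
  have hsum : ∑ x, ∑ r ∈ Finset.Ioi x, π (I r) * (π (I x) + π ((I ∘ Equiv.swap s t) x))
      = (∑ r ∈ Finset.Ioi s, π (I r)) * (π (I s) + π (I t))
        + (∑ r ∈ Finset.Ioi t, π (I r)) * (π (I s) + π (I t)) := by
    rw [Finset.sum_eq_add s t hts.ne']
    · simp only [Function.comp_apply, Equiv.swap_apply_left, Equiv.swap_apply_right,
        Finset.sum_mul, add_comm (π (I t))]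
    · intro x _ hx
      refine Finset.sum_eq_zero fun r _ => ?_
      rw [Function.comp_apply, Equiv.swap_apply_of_ne_of_ne hx.1 hx.2, ZMod2.add_self, mul_zero]
    · simp
    · simp
  have e1 := wt_eq_pre_add (π := π) I s
  have e2 := wt_eq_pre_add (π := π) I t
  have key : ∀ a b c d e f w : ZMod 2, w = e + c + a → w = f + d + b →
      a * (c + d) + b * (c + d) + (w + w) * w = (c + d) * (e + f) + d + c := by decide
  rw [hatSign, hsum, wt_swap, swapSign]
  exact key _ _ _ _ _ _ _ e1 e2

variable {S : Type*} [CommRing S] [Algebra S B] {γ : B →+* B}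

/-- The minus sign is the effect of the shifted grading: `P` contains `(-1)^{[j]}` itself rather
than a difference of degrees, so replacing `p` by `π = p + 1` changes its sign. -/
theorem hat_rMatrix (hp : ∀ i, p i = π i + 1) (hts : t < s) (a : S) :
    hat π (rMatrix p γ (algebraMap S B a) s t) = 1 - a • swapOp B π s t := by
  ext I J
  simp only [hat, Matrix.of_apply, Matrix.sub_apply, Matrix.smul_apply, swapOp, Matrix.one_apply]
  have e : rMatrix p γ (algebraMap S B a) s t I J
      = (if I = J then 1 else 0) + algebraMap S B a * permOp B p γ s t I J := rfl
  rw [e, permOp_apply (map_zero γ) (map_one γ) hts, smul_add, sub_eq_add_neg]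
  congr 1
  · split_ifs with h
    · rw [h, hatSign_self, sgn_zero, one_smul]
    · rw [smul_zero]
  · split_ifs with h
    · rw [h, hatSign_swap hts, hp, mul_smul_comm, sgn_smul_sgn_smul, mul_one,
        Algebra.algebraMap_eq_smul_one, smul_comm a, ← neg_smul]
      congr 1
      generalize swapSign π s t I = x, π (I s) = y
      revert x y
      decide
    · simp

theorem isEven_rMatrix (hts : t < s) (a : S)
    (ha : γ (algebraMap S B a) = algebraMap S B a) :
    IsEven p γ (rMatrix p γ (algebraMap S B a) s t) := by
  intro I J
  have e : rMatrix p γ (algebraMap S B a) s t I J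
      = (if I = J then 1 else 0) + algebraMap S B a * permOp B p γ s t I J := rfl
  rw [e, permOp_apply (map_zero γ) (map_one γ) hts, map_add, map_mul, ha, smul_add]
  congr 1
  · split_ifs with h
    · rw [h, ZMod2.add_self, sgn_zero, one_smul, map_one]
    · rw [smul_zero, map_zero]
  · split_ifs with h
    · rw [h, wt_swap, ZMod2.add_self, sgn_zero, one_smul, map_zsmul, map_one]
    · simp

theorem swapOp_mul_apply (Y : Matrix (Fin n → Fin 3) (Fin n → Fin 3) B) (I L : Fin n → Fin 3) :
    (swapOp B π s t * Y) I L = sgn (swapSign π s t I) • Y (I ∘ Equiv.swap s t) L := by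
  rw [Matrix.mul_apply]
  simp only [swapOp, Matrix.of_apply, ite_mul, zero_mul, Finset.sum_ite_eq', Finset.mem_univ,
    if_true, smul_mul_assoc, one_mul]

theorem mul_swapOp_apply (hts : t < s) (Y : Matrix (Fin n → Fin 3) (Fin n → Fin 3) B)
    (I L : Fin n → Fin 3) :
    (Y * swapOp B π s t) I L = sgn (swapSign π s t L) • Y I (L ∘ Equiv.swap s t) := by
  rw [Matrix.mul_apply]
  simp only [swapOp, Matrix.of_apply, eq_comp_swap_iff (J := L), mul_ite, mul_zero]
  rw [Finset.sum_ite_eq' Finset.univ (L ∘ Equiv.swap s t), if_pos (Finset.mem_univ _),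
    swapSign_swap hts, mul_smul_comm, mul_one]

theorem siteOp_mul_siteOp_apply {x y : Fin n} (hxy : x ≠ y) (M M' : Fin 3 → Fin 3 → B)
    (I L : Fin n → Fin 3) :
    (siteOp π x M * siteOp π y M') I L = if ∀ r, r ≠ x → r ≠ y → I r = L r then
      sgn ((π (I x) + π (L x)) * (π (L x) + pre π I x) + (π (I y) + π (L y)) *
        (π (L y) + (pre π I y + if x < y then π (I x) + π (L x) else 0))) •
        (M (I x) (L x) * M' (I y) (L y)) else 0 := by
  rw [siteOp_mul_apply, Finset.sum_eq_single (L x) _ (by simp)]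
  · have hiff : (∀ r, r ≠ y → Function.update I x (L x) r = L r)
        ↔ ∀ r, r ≠ x → r ≠ y → I r = L r := by
      constructor
      · intro h r hx hy
        rw [← h r hy, Function.update_of_ne hx]
      · intro h r hy
        by_cases hx : r = x
        · subst hx; rw [Function.update_self]
        · rw [Function.update_of_ne hx, h r hx hy]
    simp only [siteOp, Matrix.of_apply, hiff, Function.update_of_ne hxy.symm, pre_update]
    split_ifs
    · rw [mul_smul_comm, sgn_smul_sgn_smul]
    · rw [mul_smul_comm, sgn_smul_sgn_smul]
    · simp
  · intro m _ hm
    have : siteOp π y M' (Function.update I x m) L = 0 := by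
      rw [siteOp, Matrix.of_apply, if_neg]
      intro h
      exact hm (by rw [← h x hxy, Function.update_self])
    rw [this, mul_zero, smul_zero]

/-- The `RTT` relation. -/
theorem siteOp_rtt (hp : ∀ i, p i = π i + 1) (hts : t < s) {a : S} {M M' : Fin 3 → Fin 3 → B}
    (hM : ∀ i j k l, M i j * M' k l - sgn ((p i + p j) * (p k + p l)) • (M' k l * M i j)
      = -(sgn (p l * (p i + p j) + p i * p j) • a • (M i l * M' k j - M' i l * M k j))) :
    siteOp π t M * (siteOp π s M' * (1 - a • swapOp B π s t))
      = (1 - a • swapOp B π s t) * (siteOp π s M' * siteOp π t M) := by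
  rw [← mul_assoc, mul_sub, sub_mul, mul_one, one_mul, mul_smul_comm, smul_mul_assoc]
  ext I L
  simp only [Matrix.sub_apply, Matrix.smul_apply, mul_swapOp_apply hts, swapOp_mul_apply,
    siteOp_mul_siteOp_apply hts.ne, siteOp_mul_siteOp_apply hts.ne']
  have h1 : (∀ r, r ≠ t → r ≠ s → I r = (L ∘ Equiv.swap s t) r)
      ↔ ∀ r, r ≠ s → r ≠ t → I r = L r := by
    constructor
    · intro h r hs ht
      rw [h r ht hs, Function.comp_apply, Equiv.swap_apply_of_ne_of_ne hs ht]
    · intro h r ht hs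
      rw [h r hs ht, Function.comp_apply, Equiv.swap_apply_of_ne_of_ne hs ht]
  have h2 : (∀ r, r ≠ s → r ≠ t → (I ∘ Equiv.swap s t) r = L r)
      ↔ ∀ r, r ≠ s → r ≠ t → I r = L r := by
    constructor
    · intro h r hs ht
      rw [← h r hs ht, Function.comp_apply, Equiv.swap_apply_of_ne_of_ne hs ht]
    · intro h r hs ht
      rw [← h r hs ht, Function.comp_apply, Equiv.swap_apply_of_ne_of_ne hs ht]
  have h3 : (∀ r, r ≠ t → r ≠ s → I r = L r) ↔ ∀ r, r ≠ s → r ≠ t → I r = L r :=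
    ⟨fun h r hs ht => h r ht hs, fun h r ht hs => h r hs ht⟩
  simp only [h1, h2, h3]
  by_cases hag : ∀ r, r ≠ s → r ≠ t → I r = L r
  · simp only [if_pos hag, if_pos hts, if_neg hts.not_gt]
    have p1 : pre π L t = pre π I t :=
      pre_congr fun r hr => (hag r (hr.trans hts).ne hr.ne).symm
    have p2 : pre π L s = pre π I s + (π (I t) + π (L t)) := by
      have : pre π L s = pre π (Function.update I t (L t)) s := by
        refine pre_congr fun r hr => ?_
        by_cases hrt : r = t
        · subst hrt; rw [Function.update_self]
        · rw [Function.update_of_ne hrt, hag r hr.ne hrt]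
      rw [this, pre_update, if_pos hts]
    simp only [swapSign, p1, p2, pre_swap hts, le_refl, lt_irrefl, hts, and_true, false_and,
      if_true, if_false, add_zero, Function.comp_apply, Equiv.swap_apply_left,
      Equiv.swap_apply_right]
    have h := congrArg (fun X => sgn ((π (I t) + π (L t)) * (π (L t) + pre π I t)
      + (π (I s) + π (L s)) * (π (L s) + (pre π I s + (π (I t) + π (L t))))) • X)
      (hM (I t) (L t) (I s) (L s))
    simp only [hp, smul_sub, smul_neg, sgn_smul_sgn_smul, smul_comm (_ : ℤ) a] at h ⊢
    -- After the component relation is multiplied by the sign of `T_t T_s`, these identities match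
    -- its other terms with the reversed product and with the two products with the permutation. The
    -- variables `w`, `x` are the degrees before `s` and before `t`.
    have s2 : ∀ i j k l w x : ZMod 2, (i + j) * (j + x) + (k + l) * (l + (w + (i + j)))
        + (i + 1 + (j + 1)) * (k + 1 + (l + 1)) = (k + l) * (l + w) + (i + j) * (j + x) := by
      decide
    have s3 : ∀ i j k l w x : ZMod 2, (i + j) * (j + x) + (k + l) * (l + (w + (i + j)))
        + ((l + 1) * (i + 1 + (j + 1)) + (i + 1) * (j + 1))
        = 1 + ((l + j) * (w + (i + j) + x) + j
          + ((i + l) * (l + x) + (k + j) * (j + (w + (i + l))))) := by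
      decide
    have s4 : ∀ i j k l w x : ZMod 2, (l + j) * (w + (i + j) + x) + j
        + ((i + l) * (l + x) + (k + j) * (j + (w + (i + l)))) = (k + i) * (w + x) + i
          + ((i + l) * (l + (w + (k + i))) + (k + j) * (j + x)) := by
      decide
    have hsgn : ∀ x, sgn (1 + x) = -sgn x := by decide
    rw [s2, s3, hsgn, s4] at h
    rw [s4]
    linear_combination (norm := module) h
  · simp only [if_neg hag, smul_zero]

/-- Only the signs need an argument: an odd entry at `r` changes the degree before each of `s`, `t`
lying to its right, and the permutation changes the degree before `r` when `r` lies between them. -/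
theorem siteOp_comm_swapOp (hts : t < s) {r : Fin n} (hrs : r ≠ s) (hrt : r ≠ t)
    (M : Fin 3 → Fin 3 → B) :
    Commute (siteOp π r M) (swapOp B π s t) := by
  ext I L
  rw [mul_swapOp_apply hts, swapOp_mul_apply]
  simp only [siteOp, Matrix.of_apply]
  have h1 : (∀ x, x ≠ r → (I ∘ Equiv.swap s t) x = L x)
      ↔ ∀ x, x ≠ r → I x = (L ∘ Equiv.swap s t) x := by
    have hsw : ∀ x, x ≠ r → Equiv.swap s t x ≠ r := by
      intro x hx h
      rw [Equiv.swap_apply_eq_iff, Equiv.swap_apply_of_ne_of_ne hrs hrt] at h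
      exact hx h
    constructor
    · intro h x hx
      have := h _ (hsw x hx)
      simpa using this
    · intro h x hx
      have := h _ (hsw x hx)
      simpa using this
  simp only [h1]
  split_ifs with h
  · have es := h s hrs.symm
    have et := h t hrt.symm
    have ps := pre_eq_of_agree (π := π) h s
    have pt := pre_eq_of_agree (π := π) h t
    rw [pre_swap hts, if_pos ⟨hts, le_rfl⟩] at ps
    rw [pre_swap hts, if_neg (fun h => lt_irrefl _ h.1), add_zero] at pt
    simp only [Function.comp_apply, Equiv.swap_apply_left, Equiv.swap_apply_right,
      Equiv.swap_apply_of_ne_of_ne hrs hrt] at es et ps pt ⊢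
    rw [sgn_smul_sgn_smul, sgn_smul_sgn_smul]
    congr 2
    rw [swapSign, swapSign, pre_swap hts, es, et, pt, eq_sub_of_add_eq ps]
    -- The three identities treat `r` before both sites, between them, and after both.
    have k1 : ∀ a b c d e f g : ZMod 2,
        (a + b) * (e + (f + g) - (a + b) + (d + (f + g))) + b + (f + g) * (g + c)
          = (b + a) * (e + d) + a + (f + g) * (g + (c + 0)) := by decide
    have k2 : ∀ a b c d e f g : ZMod 2,
        (a + b) * (e + (f + g) - (a + b) + (d + 0)) + b + (f + g) * (g + c)
          = (b + a) * (e + d) + a + (f + g) * (g + (c + (b + a))) := by decide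
    have k3 : ∀ a b c d e f g : ZMod 2,
        (a + b) * (e + 0 - (a + b) + (d + 0)) + b + (f + g) * (g + c)
          = (b + a) * (e + d) + a + (f + g) * (g + (c + 0)) := by decide
    rcases lt_or_gt_of_ne hrt with hlt | hgt
    · rw [if_pos (hlt.trans hts), if_pos hlt, if_neg (by omega)]
      exact k1 _ _ _ _ _ _ _
    · rcases lt_or_gt_of_ne hrs with hlt' | hgt'
      · rw [if_pos hlt', if_neg hgt.not_gt, if_pos ⟨hgt, hlt'.le⟩]
        exact k2 _ _ _ _ _ _ _
      · rw [if_neg hgt'.not_gt, if_neg hgt.not_gt, if_neg (by omega)]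
        exact k3 _ _ _ _ _ _ _
  · simp

end RMatrix

/-! ### The super-trace as a single matrix entry -/

section Trace

variable {n : ℕ} {B : Type*} [Ring B] {p π : Fin 3 → ZMod 2} {γ : B → B}

theorem auxProd_elemAt (h0 : γ 0 = 0) (h1 : γ 1 = 1) (r k : Fin n → Fin 3) (l : List (Fin n))
    (hl : l.Pairwise (· < ·)) (I L : Fin n → Fin 3) :
    auxProd p γ (l.map fun s => elemAt B s (r s) (k s)) I L
      = if (∀ s ∈ l, I s = r s ∧ L s = k s) ∧ ∀ s, s ∉ l → I s = L s then 1 else 0 := by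
  induction l generalizing I with
  | nil =>
    have : auxProd p γ ([] : List (Aux n B)) = auxOne n B := rfl
    simp [this, auxOne, funext_iff]
  | cons s l ih =>
    rw [List.pairwise_cons] at hl
    have hs : s ∉ l := fun h => lt_irrefl _ (hl.1 s h)
    have : auxProd p γ ((s :: l).map fun s => elemAt B s (r s) (k s))
        = auxMul p γ (elemAt B s (r s) (k s)) (auxProd p γ (l.map fun s => elemAt B s (r s) (k s))) :=
      rfl
    rw [this, elemAt_mul h0 h1, ih hl.2]
    by_cases hc : (∀ x ∈ s :: l, I x = r x ∧ L x = k x) ∧ ∀ x, x ∉ s :: l → I x = L x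
    · rw [if_pos hc, if_pos (hc.1 s (by simp)).1, if_pos, Finset.sum_eq_zero, mul_zero, sgn_zero,
        one_smul]
      · intro x hx
        have hx' := Finset.mem_Iio.1 hx
        rw [hc.2 x, ZMod2.add_self]
        simp only [List.mem_cons, not_or]
        exact ⟨hx'.ne, fun h => lt_asymm hx' (hl.1 x h)⟩
      · refine ⟨fun x hx => ?_, fun x hx => ?_⟩
        · rw [Function.update_of_ne (by rintro rfl; exact hs hx)]
          exact hc.1 x (by simp [hx])
        · by_cases hxs : x = s
          · subst hxs
            rw [Function.update_self, (hc.1 x (by simp)).2]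
          · rw [Function.update_of_ne hxs]
            exact hc.2 x (by simp [hx, hxs])
    · rw [if_neg hc]
      split_ifs with h h'
      · refine absurd ⟨fun x hx => ?_, fun x hx => ?_⟩ hc
        · rcases List.mem_cons.1 hx with rfl | hxl
          · refine ⟨h, ?_⟩
            rw [← h'.2 x hs, Function.update_self]
          · have := h'.1 x hxl
            rwa [Function.update_of_ne (by rintro rfl; exact hs hxl)] at this
        · simp only [List.mem_cons, not_or] at hx
          rw [← h'.2 x hx.2, Function.update_of_ne hx.1]
      · rw [smul_zero]
      · rfl

/-- In increasing order of sites the elementary matrices multiply without sign to the matrix unit at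
`(r, k)`, so the trace retains only the `(k, r)` entry of the remaining product. The twist can be
used because `hat` does not alter diagonal entries. -/
theorem superTrace_auxProd (hπ : ∀ i j, p i + p j = π i + π j) (h0 : γ 0 = 0) (h1 : γ 1 = 1)
    (l : List (Aux n B)) (hl : ∀ X ∈ l, IsEven p γ X) (r k : Fin n → Fin 3)
    {M : Matrix (Fin n → Fin 3) (Fin n → Fin 3) B} (hM : (l.map (hat π)).prod = M) :
    superTrace p (auxProd p γ (l ++ List.ofFn fun s => elemAt B s (r s) (k s)))
      = sgn (wt p k + hatSign π r k) • M k r := by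
  have hE : ∀ I L, auxProd p γ (List.ofFn fun s => elemAt B s (r s) (k s)) I L
      = if I = r ∧ L = k then 1 else 0 := by
    intro I L
    rw [List.ofFn_eq_map, auxProd_elemAt h0 h1 r k _ (List.pairwise_lt_finRange n)]
    simp [funext_iff, forall_and]
  have hX : ∀ I, auxProd p γ (l ++ List.ofFn fun s => elemAt B s (r s) (k s)) I I
      = if I = k then sgn (hatSign π r k) • M k r else 0 := by
    intro I
    rw [← hat_apply_self (π := π) (auxProd p γ _), hat_auxProd_append hπ l _ hl, hM,
      Matrix.mul_apply]
    simp only [hat, Matrix.of_apply, hE]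
    split_ifs with h
    · subst h
      rw [Finset.sum_eq_single r]
      · rw [if_pos ⟨rfl, rfl⟩, mul_smul_comm, mul_one]
      · intro J _ hJ
        simp [hJ]
      · simp
    · simp [h]
  rw [superTrace]
  simp only [hX]
  rw [Finset.sum_eq_single k]
  · rw [if_pos rfl, sgn_smul_sgn_smul]; rfl
  · intro I _ hI
    rw [if_neg hI, smul_zero]
  · simp

end Trace

/-! ### Moving all `R`-matrices to the left -/

section Ordering

variable {R ι : Type*} [Monoid R]

/-- Used with `x k = T_k(u_k)`, `t = T_{a+j}(v_j)` and `r k = R_{a+j,k}`. The descending order of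
the `R`-matrices brings each one next to its partner. -/
theorem prod_mul_mul_reverse_prod {l : List ι} (hl : l.Nodup) (x r : ι → R) (t : R)
    (hx : ∀ k, x k * (t * r k) = r k * (t * x k)) (hc : ∀ k k', k ≠ k' → Commute (x k) (r k')) :
    (l.map x).prod * (t * (l.map r).reverse.prod) = (l.map r).reverse.prod * (t * (l.map x).prod) := by
  induction l with
  | nil => simp
  | cons k l ih =>
    rw [List.nodup_cons] at hl
    have c1 : Commute (x k) (l.map r).reverse.prod := by
      refine Commute.list_prod_right _ _ fun y hy => ?_
      obtain ⟨k', hk', rfl⟩ := List.mem_map.1 (List.mem_reverse.1 hy)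
      exact hc _ _ fun h => hl.1 (h ▸ hk')
    have c2 : Commute (l.map x).prod (r k) := by
      refine Commute.list_prod_left _ _ fun y hy => ?_
      obtain ⟨k', hk', rfl⟩ := List.mem_map.1 hy
      exact hc _ _ fun h => hl.1 (h ▸ hk')
    simp only [List.map_cons, List.prod_cons, List.reverse_cons, List.prod_append, List.prod_nil,
      mul_one]
    calc x k * (l.map x).prod * (t * ((l.map r).reverse.prod * r k))
        = x k * ((l.map x).prod * (t * (l.map r).reverse.prod)) * r k := by simp only [mul_assoc]
      _ = (x k * (l.map r).reverse.prod) * t * ((l.map x).prod * r k) := by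
        rw [ih hl.2]; simp only [mul_assoc]
      _ = (l.map r).reverse.prod * (x k * (t * r k)) * (l.map x).prod := by
        rw [c1.eq, c2.eq]; simp only [mul_assoc]
      _ = _ := by rw [hx]; simp only [mul_assoc]

/-- Used with `A = T_1(u_1) ⋯ T_a(u_a)`, `t j = T_{a+j}(v_j)` and `r j = R_{a+j,a} ⋯ R_{a+j,1}`:
each block `r j` commutes back to its own `t j`, then `A` passes the pair. -/
theorem mul_prod_mul_prod {l : List ι} (hl : l.Nodup) (A : R) (t r : ι → R)
    (hA : ∀ j, A * (t j * r j) = r j * (t j * A)) (hc : ∀ j j', j ≠ j' → Commute (t j) (r j')) :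
    A * ((l.map t).prod * (l.map r).prod) = (l.map fun j => r j * t j).prod * A := by
  induction l with
  | nil => simp
  | cons j l ih =>
    rw [List.nodup_cons] at hl
    have c1 : Commute (l.map t).prod (r j) := by
      refine Commute.list_prod_left _ _ fun y hy => ?_
      obtain ⟨k', hk', rfl⟩ := List.mem_map.1 hy
      exact hc _ _ fun h => hl.1 (h ▸ hk')
    simp only [List.map_cons, List.prod_cons]
    calc A * (t j * (l.map t).prod * (r j * (l.map r).prod))
        = A * (t j * ((l.map t).prod * r j) * (l.map r).prod) := by simp only [mul_assoc]
      _ = A * (t j * r j) * ((l.map t).prod * (l.map r).prod) := by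
        rw [c1.eq]; simp only [mul_assoc]
      _ = r j * t j * (A * ((l.map t).prod * (l.map r).prod)) := by
        rw [hA]; simp only [mul_assoc]
      _ = _ := by rw [ih hl.2]; simp only [mul_assoc]

end Ordering

/-! ### Operators that do not change the index at a given site -/

section Fixes

variable {n : ℕ} {B : Type*} [Ring B] {π : Fin 3 → ZMod 2}

/-- A matrix that is diagonal at the site `x`. -/
def FixesSite (x : Fin n) (X : Matrix (Fin n → Fin 3) (Fin n → Fin 3) B) : Prop :=
  ∀ I L, I x ≠ L x → X I L = 0

theorem FixesSite.mul {x : Fin n} {X Y : Matrix (Fin n → Fin 3) (Fin n → Fin 3) B}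
    (hX : FixesSite x X) (hY : FixesSite x Y) : FixesSite x (X * Y) := by
  intro I L h
  rw [Matrix.mul_apply]
  refine Finset.sum_eq_zero fun J _ => ?_
  by_cases hJ : I x = J x
  · rw [hY J L (hJ ▸ h), mul_zero]
  · rw [hX I J hJ, zero_mul]

theorem FixesSite.one (x : Fin n) :
    FixesSite x (1 : Matrix (Fin n → Fin 3) (Fin n → Fin 3) B) := by
  intro I L h
  rw [Matrix.one_apply_ne fun h' => h (by rw [h'])]

theorem FixesSite.list_prod {x : Fin n} {l : List (Matrix (Fin n → Fin 3) (Fin n → Fin 3) B)}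
    (hl : ∀ X ∈ l, FixesSite x X) : FixesSite x l.prod := by
  induction l with
  | nil => exact FixesSite.one x
  | cons X l ih =>
    rw [List.prod_cons]
    exact (hl X (by simp)).mul (ih fun Y hY => hl Y (by simp [hY]))

theorem fixesSite_siteOp {x s : Fin n} (h : x ≠ s) (M : Fin 3 → Fin 3 → B) :
    FixesSite x (siteOp π s M) := by
  intro I L hx
  rw [siteOp, Matrix.of_apply, if_neg fun h' => hx (h' x h)]

theorem fixesSite_one_sub_swapOp {S : Type*} [CommRing S] [Algebra S B] {x s t : Fin n}
    (hs : x ≠ s) (ht : x ≠ t) (a : S) : FixesSite x (1 - a • swapOp B π s t) := by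
  intro I L hx
  rw [Matrix.sub_apply, Matrix.smul_apply, FixesSite.one x I L hx, swapOp, Matrix.of_apply, if_neg,
    smul_zero, sub_zero]
  rintro rfl
  exact hx (by rw [Function.comp_apply, Equiv.swap_apply_of_ne_of_ne hs ht])

end Fixes

/-! ### Degrees of partial rows in the splitting into `a` vertical and `b` horizontal sites -/

section Tail

variable {a b : ℕ} {π : Fin 3 → ZMod 2}

/-- The degree of the part of a row from the `m`-th site on. -/
def tail (π : Fin 3 → ZMod 2) (J : Fin a → Fin 3) (m : ℕ) : ZMod 2 :=
  ∑ k : Fin a, if m ≤ k then π (J k) else 0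

theorem tail_val (J : Fin a → Fin 3) (k : Fin a) :
    tail π J k = π (J k) + tail π J (k + 1) := by
  have h : ∀ x : Fin a, (if (k : ℕ) ≤ x then π (J x) else 0)
      = (if x = k then π (J x) else 0) + if (k : ℕ) + 1 ≤ x then π (J x) else 0 := by
    intro x
    by_cases hx : x = k
    · subst hx; simp
    · have : (x : ℕ) ≠ k := fun h => hx (Fin.ext h)
      rw [if_neg hx, zero_add]
      congr 1
      rw [eq_iff_iff]
      omega
  rw [tail, tail, Finset.sum_congr rfl fun x _ => h x, Finset.sum_add_distrib]
  simp

theorem tail_zero (J : Fin a → Fin 3) : tail π J 0 = wt π J := by simp [tail, wt]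

theorem tail_length (J : Fin a → Fin 3) : tail π J a = 0 :=
  Finset.sum_eq_zero fun k _ => if_neg (by omega)

theorem pre_add_tail (J : Fin a → Fin 3) (k : Fin a) : pre π J k + tail π J k = wt π J := by
  rw [pre, tail, wt, ← Finset.filter_gt_eq_Iio, Finset.sum_filter, ← Finset.sum_add_distrib]
  refine Finset.sum_congr rfl fun x _ => ?_
  by_cases h : (k : ℕ) ≤ x
  · rw [if_pos h, if_neg (by omega), zero_add]
  · rw [if_neg h, if_pos (by omega), add_zero]

theorem pre_castAdd (I : Fin (a + b) → Fin 3) (k : Fin a) :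
    pre π I (Fin.castAdd b k) = pre π (fun k' => I (Fin.castAdd b k')) k := by
  rw [pre, pre, ← Finset.filter_gt_eq_Iio, ← Finset.filter_gt_eq_Iio, Finset.sum_filter,
    Finset.sum_filter, Fin.sum_univ_add]
  have : ∀ r : Fin b, ¬Fin.natAdd a r < Fin.castAdd b k := fun r h => by
    have : a + (r : ℕ) < k := h
    omega
  have h' : ∀ k' : Fin a, (Fin.castAdd b k' < Fin.castAdd b k) = (k' < k) := fun _ => rfl
  simp [this, h']

theorem pre_natAdd (I : Fin (a + b) → Fin 3) (j : Fin b)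
    (h : ∀ r, r < j → π (I (Fin.natAdd a r)) = 0) :
    pre π I (Fin.natAdd a j) = wt π fun k => I (Fin.castAdd b k) := by
  rw [pre, wt, ← Finset.filter_gt_eq_Iio, Finset.sum_filter, Fin.sum_univ_add]
  have h1 : ∀ k : Fin a, Fin.castAdd b k < Fin.natAdd a j := fun k => by
    have : (k : ℕ) < a + j := by omega
    exact this
  have h2 : ∀ r : Fin b, (if Fin.natAdd a r < Fin.natAdd a j then π (I (Fin.natAdd a r)) else 0)
      = 0 := by
    intro r
    split_ifs with hr
    · exact h r (by simpa using hr)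
    · rfl
  simp only [h1, h2, if_true, Finset.sum_const_zero, add_zero]

theorem castAdd_ne_natAdd (k : Fin a) (j : Fin b) : Fin.castAdd b k ≠ Fin.natAdd a j := by
  intro h
  have := congrArg Fin.val h
  simp at this
  omega

theorem castAdd_lt_natAdd (k : Fin a) (j : Fin b) : Fin.castAdd b k < Fin.natAdd a j := by
  have : (k : ℕ) < a + j := by omega
  exact this

theorem drop_finRange {m : ℕ} (h : m < a) :
    (List.finRange a).drop m = ⟨m, h⟩ :: (List.finRange a).drop (m + 1) := by
  rw [List.drop_eq_getElem_cons (by simpa using h)]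
  simp

end Tail

/-- The index `1` or `2`. -/
def boolIdx (i : Bool) : Fin 3 := if i then 1 else 0

/-- The weight of a straight crossing. -/
def straight (S : Type*) [CommRing S] (π : Fin 3 → ZMod 2) (i k : Bool) : S :=
  ((sgn (π (boolIdx i) * π (boolIdx k)) : ℤ) : S)

/-! ### Matrix entries of the reordered product as lattice words -/

section Rows

variable {a b : ℕ} {B X S : Type*} [Ring B] [CommRing S] [Algebra S B] {π : Fin 3 → ZMod 2}

/-- The part of a row of vertical lines at the sites in `l`. -/
def rowState (u : Fin a → X) (I : Fin (a + b) → Fin 3) (l : List (Fin a)) : List (Bool × X) :=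
  l.map fun k => (decide (I (Fin.castAdd b k) ≠ 0), u k)

theorem boolIdx_decide {i : Fin 3} (h : i ≠ 2) : boolIdx (decide (i ≠ 0)) = i := by
  revert i; decide

theorem decide_boolIdx (i : Bool) : decide (boolIdx i ≠ 0) = i := by revert i; decide

theorem boolIdx_ne_two (i : Bool) : boolIdx i ≠ 2 := by revert i; decide

theorem rowState_congr {u : Fin a → X} {I I' : Fin (a + b) → Fin 3} {l : List (Fin a)}
    (h : ∀ k ∈ l, I (Fin.castAdd b k) = I' (Fin.castAdd b k)) :
    rowState u I l = rowState u I' l :=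
  List.map_congr_left fun k hk => by rw [h k hk]

/-- The product of the monodromy matrices at the first sites. -/
theorem prod_siteOp_apply (hπ : (π 0 + π 1) * π 1 = 0) (tt : Fin 3 → Fin 3 → X → B)
    (u : Fin a → X) (l : List (Fin a)) (hl : l.Pairwise (· < ·)) (I L : Fin (a + b) → Fin 3)
    (hL : ∀ k : Fin a, L (Fin.castAdd b k) = 1) (hI : ∀ k : Fin a, I (Fin.castAdd b k) ≠ 2)
    (hIL : ∀ r, (∀ k ∈ l, r ≠ Fin.castAdd b k) → I r = L r) :
    (l.map fun k => siteOp π (Fin.castAdd b k) fun i j => tt i j (u k)).prod I L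
      = ((rowState u I l).map fun s => tt (boolIdx s.1) 1 s.2).prod := by
  induction l generalizing I with
  | nil =>
    have : I = L := funext fun r => hIL r (by simp)
    subst this
    simp [rowState]
  | cons k l ih =>
    rw [List.pairwise_cons] at hl
    have hk : k ∉ l := fun h => lt_irrefl _ (hl.1 k h)
    have hfix : FixesSite (Fin.castAdd b k)
        (l.map fun k => siteOp π (Fin.castAdd b k) fun i j => tt i j (u k)).prod := by
      refine FixesSite.list_prod fun Y hY => ?_
      obtain ⟨k', hk', rfl⟩ := List.mem_map.1 hY
      exact fixesSite_siteOp (fun h => by rw [Fin.castAdd_injective a b h] at hk; exact hk hk') _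
    rw [List.map_cons, List.prod_cons, siteOp_mul_apply, Finset.sum_eq_single 1]
    · rw [ih hl.2]
      · have hsgn : (π (I (Fin.castAdd b k)) + π 1) * (π 1 + pre π I (Fin.castAdd b k)) = 0 := by
          have h1 : (π (I (Fin.castAdd b k)) + π 1) * π 1 = 0 := by
            have : ∀ i : Fin 3, i ≠ 2 → i = 0 ∨ i = 1 := by decide
            rcases this _ (hI k) with h | h
            · rw [h, hπ]
            · rw [h, ZMod2.add_self, zero_mul]
          have h2 : pre π I (Fin.castAdd b k) = ∑ r ∈ Finset.Iio k, π 1 := by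
            rw [pre_castAdd, pre]
            refine Finset.sum_congr rfl fun r hr => ?_
            rw [hIL, hL]
            intro k' hk' h
            rw [Fin.castAdd_injective a b h, Finset.mem_Iio] at hr
            rcases List.mem_cons.1 hk' with rfl | hk'
            · exact lt_irrefl _ hr
            · exact lt_asymm hr (hl.1 _ hk')
          rw [mul_add, h1, h2, Finset.mul_sum, Finset.sum_congr rfl fun _ _ => h1]
          simp
        rw [hsgn, sgn_zero, one_smul, rowState, rowState, List.map_cons, List.map_cons,
          List.prod_cons, boolIdx_decide (hI k)]
        congr 3
        refine List.map_congr_left fun k' hk' => ?_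
        rw [Function.update_of_ne fun h => by rw [← Fin.castAdd_injective a b h] at hk; exact hk hk']
      · intro k'
        by_cases h : k' = k
        · subst h; rw [Function.update_self]; decide
        · rw [Function.update_of_ne fun h' => h (Fin.castAdd_injective a b h')]
          exact hI k'
      · intro r hr
        by_cases h : r = Fin.castAdd b k
        · subst h; rw [Function.update_self, hL]
        · rw [Function.update_of_ne h, hIL]
          intro k' hk'
          rcases List.mem_cons.1 hk' with rfl | hk'
          · exact h
          · exact hr k' hk'
    · intro m _ hm
      rw [hfix _ _ (by rw [Function.update_self, hL]; exact hm), mul_zero, smul_zero]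
    · simp

/-- The action of a product of `R`-matrices on a row. -/
theorem prod_one_sub_swapOp_mul_apply (hπ : π 2 = 0) (g : X → X → S) (u : Fin a → X) (v : X)
    (j : Fin b) (L : Fin (a + b) → Fin 3) (d m : ℕ) (hd : m + d = a)
    (Y : Matrix (Fin (a + b) → Fin 3) (Fin (a + b) → Fin 3) B)
    (F : Bool → List (Bool × X) → B) (I : Fin (a + b) → Fin 3)
    (hI : ∀ k : Fin a, I (Fin.castAdd b k) ≠ 2) (hIj : I (Fin.natAdd a j) = 1)
    (hIv : ∀ r, r < j → I (Fin.natAdd a r) = 2)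
    (hY : ∀ I' : Fin (a + b) → Fin 3, (∀ r, r ≠ Fin.natAdd a j →
        (∀ k : Fin a, m ≤ k → r ≠ Fin.castAdd b k) → I' r = I r) →
      (∀ k : Fin a, I' (Fin.castAdd b k) ≠ 2) → ∀ i, I' (Fin.natAdd a j) = boolIdx i →
      Y I' L = sgn (π (boolIdx i) * tail π (fun k => I' (Fin.castAdd b k)) m) •
        F i (rowState u I' ((List.finRange a).drop m))) :
    ((((List.finRange a).drop m).map fun k =>
        1 - g v (u k) • swapOp B π (Fin.natAdd a j) (Fin.castAdd b k)).reverse.prod * Y) I L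
      = crossLine (straight S π) (fun x y => -g x y) v
          (rowState u I ((List.finRange a).drop m)) F := by
  -- The factor of site `m` is the rightmost one of the reversed product, so it is absorbed into
  -- `Y`, and `F` becomes the crossing of that site. The sign with `tail` in `hY` accounts for the
  -- vertical lines still to be crossed; it is trivial at `m = a`.
  induction d generalizing m Y F with
  | zero =>
    obtain rfl : m = a := by omega
    have hdrop : (List.finRange m).drop m = [] := by simp
    have := hY I (fun _ _ _ => rfl) hI true hIj
    rw [tail_length, mul_zero, sgn_zero, one_smul, hdrop] at this
    rw [hdrop]
    simpa [rowState, crossLine] using this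
  | succ d ih =>
    have hm : m < a := by omega
    set k : Fin a := ⟨m, hm⟩ with hk
    rw [drop_finRange hm, List.map_cons, List.reverse_cons, List.prod_append, List.prod_cons,
      List.prod_nil, mul_one, mul_assoc]
    have hrow : ∀ I' : Fin (a + b) → Fin 3, rowState u I' (k :: (List.finRange a).drop (m + 1))
        = (decide (I' (Fin.castAdd b k) ≠ 0), u k)
          :: rowState u I' ((List.finRange a).drop (m + 1)) := fun _ => rfl
    rw [hrow, crossLine]
    refine ih (m + 1) (by omega) _ _ fun I' hI' hI2 i hi => ?_
    have hts : Fin.castAdd b k < Fin.natAdd a j := castAdd_lt_natAdd k j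
    set κ := decide (I (Fin.castAdd b k) ≠ 0) with hκ
    have hk' : I' (Fin.castAdd b k) = boolIdx κ := by
      rw [hI' _ (castAdd_ne_natAdd k j), hκ, boolIdx_decide (hI k)]
      intro k' hk' h
      have := congrArg Fin.val (Fin.castAdd_injective a b h)
      simp only [hk] at this
      omega
    have hκ' : decide (I' (Fin.castAdd b k) ≠ 0) = κ := by rw [hk', decide_boolIdx]
    rw [sub_mul, one_mul, Matrix.sub_apply, smul_mul_assoc, Matrix.smul_apply, swapOp_mul_apply]
    set I'' := I' ∘ Equiv.swap (Fin.natAdd a j) (Fin.castAdd b k) with hI''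
    have c1 : ∀ k' : Fin a, k' ≠ k → I'' (Fin.castAdd b k') = I' (Fin.castAdd b k') := by
      intro k' h
      rw [hI'', Function.comp_apply, Equiv.swap_apply_of_ne_of_ne (castAdd_ne_natAdd k' j)
        fun h' => h (Fin.castAdd_injective a b h')]
    have c2 : I'' (Fin.castAdd b k) = boolIdx i := by
      rw [hI'', Function.comp_apply, Equiv.swap_apply_right, hi]
    have c3 : I'' (Fin.natAdd a j) = boolIdx κ := by
      rw [hI'', Function.comp_apply, Equiv.swap_apply_left, hk']
    have hge : ∀ r, r ≠ Fin.natAdd a j → (∀ k' : Fin a, m ≤ k' → r ≠ Fin.castAdd b k') →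
        I' r = I r := fun r hr hr' => hI' r hr fun k' hk' => hr' k' (by omega)
    rw [hY I' hge hI2 i hi, hY I'' _ _ κ c3]
    · have hmem : ∀ k' ∈ (List.finRange a).drop (m + 1), k' ≠ k := by
        intro k' hk' h
        have hs : (List.drop m (List.finRange a)).Nodup :=
          (List.nodup_finRange a).sublist (List.drop_sublist _ _)
        rw [drop_finRange hm, List.nodup_cons] at hs
        rw [h] at hk'
        exact hs.1 hk'
      rw [drop_finRange hm, hrow, hrow, rowState_congr (I := I'') (I' := I')
        fun k' hk' => c1 k' (hmem k' hk'), hκ', c2, decide_boolIdx]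
      have ht : ∀ J : Fin a → Fin 3, tail π J m = π (J k) + tail π J (m + 1) := fun J =>
        tail_val J k
      have ht' : tail π (fun k => I'' (Fin.castAdd b k)) (m + 1)
          = tail π (fun k => I' (Fin.castAdd b k)) (m + 1) := by
        refine Finset.sum_congr rfl fun k' _ => ?_
        split_ifs with h
        · dsimp only
          rw [c1 k' fun h' => by rw [h', hk] at h; simp at h]
        · rfl
      -- The earlier horizontal lines carry index `3`, of degree `0` for `π`, so only the vertical
      -- sites from `k` on contribute.
      have hpre : pre π I' (Fin.natAdd a j) + pre π I' (Fin.castAdd b k)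
          = π (boolIdx κ) + tail π (fun k => I' (Fin.castAdd b k)) (m + 1) := by
        rw [pre_natAdd, pre_castAdd, ← pre_add_tail _ k, ht (fun k => I' (Fin.castAdd b k)), hk']
        · linear_combination ZMod2.add_self (pre π (fun k' => I' (Fin.castAdd b k')) k)
        · intro r hr
          rw [hI' _ (fun h => hr.ne (Fin.natAdd_injective b a h))
            (fun k' _ => (castAdd_ne_natAdd k' r).symm), hIv r hr, hπ]
      rw [ht, ht, ht', c2, hk', swapSign, hpre, hi, hk', sgn_smul_sgn_smul, straight,
        Int.cast_smul_eq_zsmul, smul_add, sgn_smul_sgn_smul, sub_eq_add_neg, neg_smul, smul_neg,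
        smul_comm _ (g v (u k))]
      generalize tail π (fun k => I' (Fin.castAdd b k)) (m + 1) = τ
      generalize π (boolIdx i) = x, π (boolIdx κ) = y
      -- Relative to the sign with the shorter tail, straight passage costs `(-1)^{xy}`, the weight
      -- `straight`, and the exchange costs nothing.
      have e1 : ∀ x y τ : ZMod 2, x * (y + τ) = x * τ + x * y := by decide
      have e2 : ∀ x y τ : ZMod 2, (x + y) * (y + τ) + y + y * (x + τ) = x * τ := by decide
      rw [e1, e2]
    · intro r hr hr'
      rw [hI'', Function.comp_apply, Equiv.swap_apply_of_ne_of_ne hr (hr' k le_rfl)]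
      exact hge r hr hr'
    · intro k'
      by_cases h : k' = k
      · rw [h, c2]; exact boolIdx_ne_two i
      · rw [c1 k' h]; exact hI2 k'

theorem prod_rows_apply (hπ1 : (π 0 + π 1) * π 1 = 0) (hπ2 : π 2 = 0) (g : X → X → S)
    (tt : Fin 3 → Fin 3 → X → B) (u : Fin a → X) (v : Fin b → X) (L : Fin (a + b) → Fin 3)
    (hLu : ∀ k : Fin a, L (Fin.castAdd b k) = 1) (hLv : ∀ j : Fin b, L (Fin.natAdd a j) = 2)
    (d m : ℕ) (hd : m + d = b) (I : Fin (a + b) → Fin 3)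
    (hI : ∀ k : Fin a, I (Fin.castAdd b k) ≠ 2)
    (hIv : ∀ r : Fin b, I (Fin.natAdd a r) = if (r : ℕ) < m then 2 else 1) :
    ((((List.finRange b).drop m).map fun j =>
        ((List.finRange a).map fun k =>
          1 - g (v j) (u k) • swapOp B π (Fin.natAdd a j) (Fin.castAdd b k)).reverse.prod
          * siteOp π (Fin.natAdd a j) fun i k => tt i k (v j)).prod
        * ((List.finRange a).map fun k => siteOp π (Fin.castAdd b k) fun i j => tt i j (u k)).prod)
        I L
      = latticeWord (straight S π) (fun x y => -g x y) (fun i x => tt (boolIdx i) 1 x)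
          (fun i x => tt (boolIdx i) 2 x) (((List.finRange b).drop m).map v)
          (rowState u I (List.finRange a)) := by
  -- Here `m` counts the horizontal lines that have already been turned into index `3`.
  induction d generalizing m I with
  | zero =>
    obtain rfl : m = b := by omega
    have hdrop : (List.finRange m).drop m = [] := by simp
    rw [hdrop, List.map_nil, List.map_nil, List.prod_nil, one_mul, latticeWord]
    refine prod_siteOp_apply hπ1 tt u _ (List.pairwise_lt_finRange a) I L hLu hI fun r hr => ?_
    induction r using Fin.addCases with
    | left k => exact absurd rfl (hr k (List.mem_finRange k))
    | right j => rw [hIv, hLv, if_pos j.2]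
  | succ d ih =>
    have hm : m < b := by omega
    set j : Fin b := ⟨m, hm⟩ with hj
    rw [drop_finRange hm, List.map_cons, List.map_cons, List.prod_cons, latticeWord, mul_assoc,
      mul_assoc]
    set Z := ((((List.finRange b).drop (m + 1)).map fun j =>
        ((List.finRange a).map fun k =>
          1 - g (v j) (u k) • swapOp B π (Fin.natAdd a j) (Fin.castAdd b k)).reverse.prod
          * siteOp π (Fin.natAdd a j) fun i k => tt i k (v j)).prod
        * ((List.finRange a).map fun k => siteOp π (Fin.castAdd b k) fun i j => tt i j (u k)).prod)
      with hZ
    -- No later factor acts at the site of line `j`, so its monodromy matrix must already produce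
    -- the final index `3`.
    have hfix : FixesSite (Fin.natAdd a j) Z := by
      refine FixesSite.mul (FixesSite.list_prod fun Y hY => ?_)
        (FixesSite.list_prod fun Y hY => ?_)
      · obtain ⟨j', hj', rfl⟩ := List.mem_map.1 hY
        have hne : Fin.natAdd a j ≠ Fin.natAdd a j' := by
          intro h
          have hs : (List.drop m (List.finRange b)).Nodup :=
            (List.nodup_finRange b).sublist (List.drop_sublist _ _)
          rw [drop_finRange hm, List.nodup_cons] at hs
          rw [← Fin.natAdd_injective b a h] at hj'
          exact hs.1 hj'
        refine FixesSite.mul (FixesSite.list_prod fun Y hY => ?_) (fixesSite_siteOp hne _)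
        obtain ⟨k, _, rfl⟩ := List.mem_map.1 (List.mem_reverse.1 hY)
        exact fixesSite_one_sub_swapOp hne (castAdd_ne_natAdd k j).symm _
      · obtain ⟨k, _, rfl⟩ := List.mem_map.1 hY
        exact fixesSite_siteOp (castAdd_ne_natAdd k j).symm _
    have key := prod_one_sub_swapOp_mul_apply hπ2 g u (v j) j L a 0 (by omega)
      (siteOp π (Fin.natAdd a j) (fun i k => tt i k (v j)) * Z)
      (fun i r => tt (boolIdx i) 2 (v j) * latticeWord (straight S π) (fun x y => -g x y)
        (fun i x => tt (boolIdx i) 1 x) (fun i x => tt (boolIdx i) 2 x)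
        (((List.finRange b).drop (m + 1)).map v) r) I hI (by rw [hIv, if_neg (by simp [hj])])
      (fun r hr => by rw [hIv, if_pos (by exact hr)])
    rw [List.drop_zero] at key
    refine key fun I' hI' hI2 i hi => ?_
    have hv' : ∀ r : Fin b, r ≠ j → I' (Fin.natAdd a r) = if (r : ℕ) < m + 1 then 2 else 1 := by
      intro r hr
      have : (r : ℕ) ≠ m := fun h => hr (Fin.ext h)
      rw [hI' _ (fun h => hr (Fin.natAdd_injective b a h))
        (fun k' _ => (castAdd_ne_natAdd k' r).symm), hIv]
      congr 1
      rw [eq_iff_iff]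
      omega
    rw [siteOp_mul_apply, Finset.sum_eq_single 2]
    · rw [hZ, ih (m + 1) (by omega)]
      -- The sign of the entry `T_{i3}` is the degree of `i` times that of the whole row, exactly
      -- the `tail` sign at `m = 0` required by `key`.
      · rw [pre_natAdd, tail_zero, hπ2, zero_add, add_zero, hi]
        · congr 2
          · congr 1
            refine rowState_congr fun k _ => ?_
            rw [Function.update_of_ne (castAdd_ne_natAdd k j)]
        · intro r hr
          rw [hv' r hr.ne, if_pos (by have : (r : ℕ) < m := hr; omega), hπ2]
      · intro k
        rw [Function.update_of_ne (castAdd_ne_natAdd k j)]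
        exact hI2 k
      · intro r
        by_cases h : r = j
        · subst h
          rw [Function.update_self, if_pos (by simp [hj])]
        · rw [Function.update_of_ne fun h' => h (Fin.natAdd_injective b a h'), hv' r h]
    · intro q _ hq
      rw [hfix _ _ (by rw [Function.update_self, hLv]; exact hq), mul_zero, smul_zero]
    · simp

end Rows

/-! ### The trace as a lattice word, with its overall sign -/

section TraceLattice

variable {N : ℕ} {p : Fin 3 → ZMod 2} {c : ℂ}

theorem siteOp_comm_one_sub_swapOp {n : ℕ} {B S : Type*} [Ring B] [CommRing S] [Algebra S B]
    {π : Fin 3 → ZMod 2} {s t r : Fin n} (hts : t < s) (hrs : r ≠ s) (hrt : r ≠ t)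
    (M : Fin 3 → Fin 3 → B) (a : S) :
    Commute (siteOp π r M) (1 - a • swapOp B π s t) :=
  (Commute.one_right _).sub_right ((siteOp_comm_swapOp hts hrs hrt M).smul_right a)

theorem monodromy_siteOp_rtt {n : ℕ} {π : Fin 3 → ZMod 2} (hp : ∀ i, p i = π i + 1)
    {s t : Fin n} (hts : t < s) {x y : Fin N} (hxy : x ≠ y) :
    siteOp π t (fun i j => monodromy p c i j x) * (siteOp π s (fun i j => monodromy p c i j y)
        * (1 - gFun c y x • swapOp (YSeries N p c) π s t))
      = (1 - gFun c y x • swapOp (YSeries N p c) π s t)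
        * (siteOp π s (fun i j => monodromy p c i j y)
          * siteOp π t (fun i j => monodromy p c i j x)) := by
  refine siteOp_rtt hp hts fun i j k l => ?_
  have hneg : ∀ X : YSeries N p c, gFun c x y • X = -(gFun c y x • X) := fun X => by
    rw [gFun_anti y x]
    exact neg_smul (R := Scal N) (M := YSeries N p c) _ _
  rw [monodromy_comm hxy, hneg, smul_neg]

theorem intCast_smul (n : ℤ) (X : YSeries N p c) : ((n : ℤ) : Scal N) • X = n • X :=
  Int.cast_smul_eq_zsmul (Scal N) n X

theorem prod_traceElement {π : Fin 3 → ZMod 2} (hp : ∀ i, p i = π i + 1) {a b : ℕ}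
    (u : Fin a → Fin N) (v : Fin b → Fin N) (huv : ∀ k j, u k ≠ v j) :
    (((List.ofFn fun k => atSite (Fin.castAdd b k) fun i j => monodromy p c i j (u k)) ++
      (List.ofFn fun k => atSite (Fin.natAdd a k) fun i j => monodromy p c i j (v k)) ++
      (List.ofFn fun j => (List.ofFn fun k =>
        rMatrix p (grSeries p c) (scal p c (gFun c (v j) (u k))) (Fin.natAdd a j)
          (Fin.castAdd b k)).reverse).flatten).map (hat π)).prod
      = (((List.finRange b).map fun j =>
        ((List.finRange a).map fun k =>
          1 - gFun c (v j) (u k) •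
            swapOp (YSeries N p c) π (Fin.natAdd a j) (Fin.castAdd b k)).reverse.prod
          * siteOp π (Fin.natAdd a j) fun i k => monodromy p c i k (v j)).prod
        * ((List.finRange a).map fun k =>
          siteOp π (Fin.castAdd b k) fun i j => monodromy p c i j (u k)).prod) := by
  have hts : ∀ (k : Fin a) (j : Fin b), Fin.castAdd b k < Fin.natAdd a j := castAdd_lt_natAdd
  have hR : ∀ (j : Fin b) (k : Fin a),
      hat π (rMatrix p (grSeries p c) (scal p c (gFun c (v j) (u k))) (Fin.natAdd a j)
          (Fin.castAdd b k))
        = 1 - gFun c (v j) (u k) •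
            swapOp (YSeries N p c) π (Fin.natAdd a j) (Fin.castAdd b k) := fun j k =>
    hat_rMatrix (γ := grHom N p c) hp (hts k j) (gFun c (v j) (u k))
  have hc : ∀ (r : Fin (a + b)) (j : Fin b) (k : Fin a), r ≠ Fin.natAdd a j →
      r ≠ Fin.castAdd b k → ∀ M : Fin 3 → Fin 3 → YSeries N p c, Commute (siteOp π r M)
        (1 - gFun c (v j) (u k) •
            swapOp (YSeries N p c) π (Fin.natAdd a j) (Fin.castAdd b k)) :=
    fun r j k h h' M => siteOp_comm_one_sub_swapOp (hts k j) h h' M _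
  simp only [List.ofFn_eq_map, List.map_append, List.prod_append, List.map_map, List.map_flatten,
    List.prod_flatten, Function.comp_def, List.map_reverse, hat_atSite, hR]
  rw [mul_assoc, ← mul_prod_mul_prod (List.nodup_finRange b)]
  · intro j
    refine prod_mul_mul_reverse_prod (List.nodup_finRange a) _ _ _ (fun k => ?_) fun k k' hk => ?_
    · exact monodromy_siteOp_rtt hp (hts k j) (huv k j)
    · exact hc _ _ _ (castAdd_ne_natAdd k j) (fun h => hk (Fin.castAdd_injective a b h)) _
  · intro j j' hj
    refine Commute.list_prod_right _ _ fun y hy => ?_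
    obtain ⟨k, _, rfl⟩ := List.mem_map.1 (List.mem_reverse.1 hy)
    exact hc _ _ _ (fun h => hj (Fin.natAdd_injective b a h)) (castAdd_ne_natAdd k j).symm _

/-- The double sum in `hatSign` vanishes: its terms contain either the degree of index `3`, which is
`0` after the shift, or a product `(q + 1) q`. Only the products of total weights remain. -/
theorem wt_add_hatSign_append (h0 : p 0 = 0) (h2 : p 2 = 1) (a b : ℕ) :
    wt p (Fin.append (fun _ => 0) (fun _ => 1) : Fin (a + b) → Fin 3)
      + hatSign (fun i => p i + 1) (Fin.append (fun _ => 1) (fun _ => 2) : Fin (a + b) → Fin 3)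
        (Fin.append (fun _ => 0) (fun _ => 1) : Fin (a + b) → Fin 3)
      = b + a * p 1 + (p 1 + 1) * (a * b : ℕ) := by
  have hz : ∀ q : ZMod 2, (1 + 1 : ZMod 2) = 0 ∧ (q + 1) * q = 0 ∧ q + q = 0 ∧ q * q = q := by
    decide
  have hs : ∀ s r : Fin (a + b),
      (p ((Fin.append (fun _ => 1) (fun _ => 2) : Fin (a + b) → Fin 3) r) + 1)
        * (p ((Fin.append (fun _ => 1) (fun _ => 2) : Fin (a + b) → Fin 3) s) + 1
          + (p ((Fin.append (fun _ => 0) (fun _ => 1) : Fin (a + b) → Fin 3) s) + 1))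
        = if s < r then 0 else
          (p ((Fin.append (fun _ => 1) (fun _ => 2) : Fin (a + b) → Fin 3) r) + 1)
        * (p ((Fin.append (fun _ => 1) (fun _ => 2) : Fin (a + b) → Fin 3) s) + 1
          + (p ((Fin.append (fun _ => 0) (fun _ => 1) : Fin (a + b) → Fin 3) s) + 1)) := by
    intro s r
    split_ifs with h
    · induction r using Fin.addCases with
      | right r => simp [h2, (hz 0).1]
      | left r =>
        induction s using Fin.addCases with
        | left s =>
          simp only [Fin.append_left, h0]
          generalize p 1 = q; revert q; decide
        | right s =>
          have : a + (s : ℕ) < r := h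
          omega
    · rfl
  rw [hatSign, Finset.sum_eq_zero fun s _ => Finset.sum_eq_zero fun r hr => by
    rw [hs, if_pos (Finset.mem_Ioi.1 hr)]]
  simp only [wt, Fin.sum_univ_add, Fin.append_left, Fin.append_right, h0, h2, (hz 0).1]
  simp only [Finset.sum_const, Finset.card_univ, Fintype.card_fin, nsmul_eq_mul, Nat.cast_mul]
  generalize p 1 = q
  generalize (a : ZMod 2) = x, (b : ZMod 2) = y
  revert q x y; decide

/-- The weights obtained from the matrices differ from those with `ε = (-1)^{[2]}` by the factor
`(-1)^{[2]+1}` at each of the `ab` crossings. This cancels the `ab` term in the sign of the selected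
entry. -/
theorem traceElement_eq (h0 : p 0 = 0) (h2 : p 2 = 1) (u v : List (Fin N))
    (huv : ∀ x ∈ u, ∀ y ∈ v, x ≠ y) :
    traceElement p c u v = sgn (v.length + u.length * p 1) •
      latticeWord (bSign ((sgn (p 1) : ℤ) : Scal N))
        (fun x y => ((sgn (p 1) : ℤ) : Scal N) * gFun c x y)
        (fun i x => monodromy p c (boolIdx i) 1 x) (fun i x => monodromy p c (boolIdx i) 2 x)
        v (ones u) := by
  have hp : ∀ i, p i = (fun i => p i + 1) i + 1 := fun i => by
    have : ∀ x : ZMod 2, x = x + 1 + 1 := by decide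
    exact this _
  have hπ : ∀ i j, p i + p j = (fun i => p i + 1) i + (fun i => p i + 1) j := fun i j => by
    have : ∀ x y : ZMod 2, x + y = x + 1 + (y + 1) := by decide
    exact this _ _
  have hts : ∀ (k : Fin u.length) (j : Fin v.length),
      Fin.castAdd v.length k < Fin.natAdd u.length j := castAdd_lt_natAdd
  have hM := prod_traceElement (c := c) hp u.get v.get fun k j =>
    huv _ (List.get_mem _ _) _ (List.get_mem _ _)
  have hofFn : ((List.ofFn fun k => elemAt (YSeries N p c) (Fin.castAdd v.length k) 1 0) ++
      (List.ofFn fun k => elemAt (YSeries N p c) (Fin.natAdd u.length k) 2 1))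
      = List.ofFn fun s => elemAt (YSeries N p c) s
        ((Fin.append (fun _ => 1) (fun _ => 2) : Fin (u.length + v.length) → Fin 3) s)
        ((Fin.append (fun _ => 0) (fun _ => 1) : Fin (u.length + v.length) → Fin 3) s) := by
    rw [List.ofFn_add]
    congr 1 <;> refine congrArg List.ofFn (funext fun k => ?_)
    · change _ = elemAt _ (Fin.castAdd v.length k) (Fin.append _ _ (Fin.castAdd v.length k))
        (Fin.append _ _ (Fin.castAdd v.length k))
      rw [Fin.append_left, Fin.append_left]
    · rw [Fin.append_right, Fin.append_right]
  rw [traceElement]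
  rw [List.append_assoc, hofFn, superTrace_auxProd (γ := grSeries p c) hπ (map_zero (grHom N p c))
    (map_one (grHom N p c)) _ _ _ _ hM, wt_add_hatSign_append h0 h2]
  · have key := prod_rows_apply (π := fun i => p i + 1)
      (by rw [h0]; generalize p 1 = q; revert q; decide) (by rw [h2]; rfl) (gFun c)
      (monodromy p c) u.get v.get
      (Fin.append (fun _ => 1) (fun _ => 2) : Fin (u.length + v.length) → Fin 3)
      (by simp) (by simp) v.length 0 (by simp)
      (Fin.append (fun _ => 0) (fun _ => 1) : Fin (u.length + v.length) → Fin 3)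
      (by simp) (by simp)
    rw [List.drop_zero] at key
    rw [key]
    have hrow : rowState u.get
        (Fin.append (fun _ => 0) (fun _ => 1) : Fin (u.length + v.length) → Fin 3)
        (List.finRange u.length) = ones u := by
      simp only [rowState, Fin.append_left, ones]
      conv_rhs => rw [← List.map_get_finRange u, List.map_map]
      simp [Function.comp_def]
    have hst : straight (Scal N) (fun i => p i + 1) = fun i k =>
        ((sgn (p 1 + 1) : ℤ) : Scal N) * bSign ((sgn (p 1) : ℤ) : Scal N) i k := by
      funext i k
      simp only [straight, bSign]
      have : ∀ q : ZMod 2, q = 0 ∨ q = 1 := by decide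
      rcases this (p 1) with h | h <;> cases i <;> cases k <;>
        simp [boolIdx, h0, h, sgn, show (1 + 1 : ZMod 2) = 0 from rfl]
    have hex : (fun x y : Fin N => -gFun c x y) = fun x y =>
        ((sgn (p 1 + 1) : ℤ) : Scal N) * (((sgn (p 1) : ℤ) : Scal N) * gFun c x y) := by
      funext x y
      have : ∀ q : ZMod 2, sgn (q + 1) * sgn q = -1 := by decide
      rw [← mul_assoc, ← Int.cast_mul, this, Int.cast_neg, Int.cast_one]
      exact (neg_one_mul (gFun c x y)).symm
    rw [hrow, hst, hex, List.map_get_finRange, latticeWord_scale, ones, List.length_map,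
      ← Int.cast_pow, intCast_smul, smul_smul]
    congr 1
    have hpow : ∀ (q : ZMod 2) (n : ℕ), sgn q ^ n = sgn (q * n) := by
      intro q n
      induction n with
      | zero => simp [sgn_zero]
      | succ n ih => rw [pow_succ, ih, sgn_mul_sgn]; congr 1; push_cast; ring
    rw [hpow, sgn_mul_sgn, add_assoc, ZMod2.add_self, add_zero]
  · intro X hX
    simp only [List.mem_append, List.mem_ofFn, List.mem_flatten, exists_exists_eq_and,
      List.mem_reverse] at hX
    rcases hX with (⟨k, rfl⟩ | ⟨k, rfl⟩) | ⟨j, k, rfl⟩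
    · exact isEven_atSite (map_zero (grHom N p c)) fun i j => grSeries_monodromy i j _
    · exact isEven_atSite (map_zero (grHom N p c)) fun i j => grSeries_monodromy i j _
    · exact isEven_rMatrix (γ := grHom N p c) (hts k j) (gFun c (v.get j) (u.get k))
        (grSeries_scal _)

end TraceLattice

/-! ### The action on the singular vector -/

section BetheVectors

variable {N : ℕ} {p : Fin 3 → ZMod 2} {c : ℂ}

/-- The word of the lattice model that represents the trace in a Bethe vector. -/
def betheWord (p : Fin 3 → ZMod 2) (c : ℂ) (u v : List (Fin N)) : YSeries N p c :=
  latticeWord (bSign ((sgn (p 1) : ℤ) : Scal N))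
    (fun x y => ((sgn (p 1) : ℤ) : Scal N) * gFun c x y)
    (fun i x => monodromy p c (boolIdx i) 1 x) (fun i x => monodromy p c (boolIdx i) 2 x)
    v (ones u)

theorem exchange_of_comm {S A : Type*} [CommRing S] [AddCommGroup A] [Module S A] {P Q R : A}
    {e g d : S} (h : P - d • R = e • g • (P - Q)) : (1 - e * g) • P + (e * g) • Q = d • R := by
  linear_combination (norm := module) h

theorem monodromy_exchange (h0 : p 0 = 0) {x y : Fin N} (hxy : x ≠ y) (k l : Bool) :
    (1 - ((sgn (p 1) : ℤ) : Scal N) * gFun c x y) •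
        (monodromy p c (boolIdx k) 1 x * monodromy p c (boolIdx l) 1 y)
      + (((sgn (p 1) : ℤ) : Scal N) * gFun c x y) •
        (monodromy p c (boolIdx k) 1 y * monodromy p c (boolIdx l) 1 x)
      = bSign ((sgn (p 1) : ℤ) : Scal N) k l •
        (monodromy p c (boolIdx l) 1 y * monodromy p c (boolIdx k) 1 x) := by
  have h := monodromy_comm (c := c) (p := p) hxy (boolIdx k) 1 (boolIdx l) 1
  have e1 : p 1 * (p (boolIdx k) + p 1) + p (boolIdx k) * p 1 = p 1 := by
    generalize p 1 = q, p (boolIdx k) = r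
    revert q r; decide
  have e2 : bSign ((sgn (p 1) : ℤ) : Scal N) k l
      = ((sgn ((p (boolIdx k) + p 1) * (p (boolIdx l) + p 1)) : ℤ) : Scal N) := by
    have hq : ∀ q : ZMod 2, q * q = q := by decide
    have q1 := hq (p 1)
    cases k <;> cases l <;> simp [bSign, boolIdx, h0, q1, sgn_zero, ZMod2.add_self]
  rw [e1, ← intCast_smul, ← intCast_smul, ← e2] at h
  exact exchange_of_comm h

variable {V : Type*} [AddCommGroup V] [Module (Yangian p c) V]

theorem coeff_smul_constVec (X : YSeries N p c) (w : V) (e : Expo N) :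
    ((HahnModule.of (Yangian p c)).symm (X • constVec p c w)).coeff e = X.coeff e • w := by
  have hw : (HahnModule.of (Yangian p c)).symm (constVec p c w : VSeries N p c V)
      = HahnSeries.single 0 w := rfl
  rw [HahnModule.coeff_smul, Finset.sum_eq_single (e, 0), hw, HahnSeries.coeff_single_same]
  · rintro ⟨a, b⟩ hab hne
    rw [Finset.mem_vaddAntidiagonal] at hab
    by_cases hb : b = 0
    · subst hb
      refine absurd ?_ hne
      rw [← hab.2.2, vadd_eq_add, add_zero]
    · rw [hw, HahnSeries.coeff_single_of_ne hb, smul_zero]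
  · intro h
    rw [Finset.mem_vaddAntidiagonal, not_and_or, not_and_or] at h
    rcases h with h | h | h
    · rw [show X.coeff (e, (0 : Expo N)).1 = 0 from not_not.1 h]
      exact zero_smul _ _
    · rw [show ((HahnModule.of (Yangian p c)).symm (constVec p c w : VSeries N p c V)).coeff
        ((e, (0 : Expo N)).2) = 0 from not_not.1 h, smul_zero]
    · exact absurd (add_zero e) h

theorem monodromy_smul_constVec {Ω : V} {lam : Fin 3 → ℕ → ℂ} (hΩ : IsSingular p c Ω lam)
    (i : Fin 3) (x : Fin N) :
    monodromy p c i i x • (constVec p c Ω : VSeries N p c V)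
      = scal p c (weight c (lam i) x) • constVec p c Ω := by
  apply (HahnModule.of (Yangian p c)).symm.injective
  ext e
  rw [coeff_smul_constVec, coeff_smul_constVec]
  change _ = algebraMap ℂ (Yangian p c) ((weight c (lam i) x).coeff e) • Ω
  by_cases h : ∃ n, e = invPow x n
  · obtain ⟨n, rfl⟩ := h
    rw [monodromy, weight, coeff_evalAt_invPow, coeff_evalAt_invPow, monodromySeries,
      PowerSeries.coeff_mk, PowerSeries.coeff_mk]
    cases n with
    | zero => simp [freeCoeff]
    | succ n =>
      have : toYangian p c (freeCoeff c i i (n + 1))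
          = algebraMap ℂ _ (c ^ (n + 1)) * mode p c i i n := by
        rw [freeCoeff, map_smul, Algebra.smul_def]; rfl
      rw [this, mul_smul, hΩ.diag, ← mul_smul, ← map_mul, mul_comm]
  · have h1 : (monodromy p c i i x).coeff e = 0 := by
      by_contra h'
      exact h (exists_of_coeff_evalAt_ne_zero h')
    have h2 : (weight c (lam i) x).coeff e = 0 := by
      by_contra h'
      exact h (exists_of_coeff_evalAt_ne_zero h')
    rw [h1, h2, map_zero]

theorem betheWord_smul_constVec (h0 : p 0 = 0) {Ω : V} {lam : Fin 3 → ℕ → ℂ}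
    (hΩ : IsSingular p c Ω lam) (u : List (Fin N)) (z : Fin N) (v : List (Fin N))
    (huv : (u ++ z :: v).Nodup) :
    betheWord p c u (z :: v) • (constVec p c Ω : VSeries N p c V)
      = monodromy p c 1 2 z • betheWord p c u v • constVec p c Ω
        + ∑ j : Fin u.length, scal p c (weight c (lam 1) (u.get j)
            * (((sgn (p 1) : ℤ) : Scal N) * gFun c z (u.get j)
              * hopCoeff ((sgn (p 1) : ℤ) : Scal N) (gFun c) u j
              * (v.map fun y => 1 + ((sgn (p 1) : ℤ) : Scal N) * gFun c y (u.get j)).prod)) •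
          monodromy p c 0 2 z • betheWord p c (u.eraseIdx j) v • constVec p c Ω := by
  -- Scalars act through the series over the super-Yangian, so that `X ↦ X • Ω` becomes the linear
  -- map `φ` of the abstract recursion.
  let _ : Module (Scal N) (VSeries N p c V) := Module.compHom _ (scalHom N p c)
  let φ : YSeries N p c →ₗ[Scal N] VSeries N p c V :=
    { toFun := fun X => X • constVec p c Ω
      map_add' := fun X Y => add_smul X Y _
      map_smul' := fun x X => mul_smul (scal p c x) X _ }
  have key := latticeWord_recursion (S := Scal N) (ε := ((sgn (p 1) : ℤ) : Scal N))
    (g := gFun c) (t₂ := fun i x => monodromy p c (boolIdx i) 1 x)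
    (t₃ := fun i x => monodromy p c (boolIdx i) 2 x)
    (by
      have : ∀ q : ZMod 2, sgn q * sgn q = 1 := by decide
      rw [← Int.cast_mul, this, Int.cast_one])
    (fun x y _ => gFun_anti x y) (fun _ _ _ => gFun_rel)
    (fun x y hxy k l => monodromy_exchange h0 hxy k l) φ (weight c (lam 1))
    (fun (X Y : YSeries N p c) x => by
      change (X * (Y * monodromy p c 1 1 x)) • (constVec p c Ω : VSeries N p c V)
        = scal p c (weight c (lam 1) x) • (X * Y) • (constVec p c Ω : VSeries N p c V)
      rw [← mul_assoc, mul_smul, monodromy_smul_constVec hΩ, ← mul_smul, ← mul_smul, scal_comm])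
    u z v huv
  have hφ : ∀ X Y : YSeries N p c, φ (X * Y) = X • Y • (constVec p c Ω : VSeries N p c V) :=
    fun X Y => mul_smul X Y (constVec p c Ω : VSeries N p c V)
  simp only [hφ] at key
  exact key

end BetheVectors

/-! ### Comparison of coefficients with the normalisation `H` -/

section Coefficients

variable {N : ℕ} {c : ℂ}

theorem bigH_cons (x : Fin N) (w : List (Fin N)) :
    bigH c (x :: w) = (w.map fun y => hFun c y x).prod * bigH c w := by
  rw [bigH, bigH]
  change ∏ k : Fin (w.length + 1), _ = _
  rw [Fin.prod_univ_succ]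
  congr 1
  · refine (Fin.prod_Ioi_zero (n := w.length)
      (f := fun j : Fin (w.length + 1) => hFun c ((x :: w).get j) x)).trans ?_
    rw [← List.prod_ofFn]
    conv_rhs => rw [← List.ofFn_get w, List.map_ofFn]
    rfl
  · refine Finset.prod_congr rfl fun k _ => ?_
    exact Fin.prod_Ioi_succ (n := w.length)
      (fun j : Fin (w.length + 1) => hFun c ((x :: w).get j) (w.get k)) k

theorem bigH_append_cons (l l' : List (Fin N)) (x : Fin N) :
    bigH c (l ++ x :: l') = (l.map fun y => hFun c x y).prod * (l'.map fun y => hFun c y x).prod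
      * bigH c (l ++ l') := by
  induction l with
  | nil => simp [bigH_cons]
  | cons z l ih =>
    simp only [List.cons_append, bigH_cons, ih, List.map_append, List.map_cons, List.prod_append,
      List.prod_cons]
    ring

theorem gFun_ne_zero (hc : c ≠ 0) {x y : Fin N} (hxy : x ≠ y) : gFun c x y ≠ 0 :=
  div_ne_zero (fun h => hc (HahnSeries.C_injective (h.trans (map_zero _).symm)))
    (par_sub_par_ne_zero hxy)

theorem bigH_ne_zero (hc : c ≠ 0) {w : List (Fin N)} (hw : w.Nodup) : bigH c w ≠ 0 := by
  induction w with
  | nil => simp [bigH]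
  | cons x w ih =>
    rw [List.nodup_cons] at hw
    rw [bigH_cons]
    refine mul_ne_zero (List.prod_ne_zero fun h => ?_) (ih hw.2)
    obtain ⟨y, hy, h⟩ := List.mem_map.1 h
    have hyx : y ≠ x := by rintro rfl; exact hw.1 hy
    exact div_ne_zero (fFun_ne_zero hyx) (gFun_ne_zero hc hyx) h

theorem hopCoeff_one (w : List (Fin N)) (j : Fin w.length) :
    hopCoeff (1 : Scal N) (gFun c) w j = ((w.eraseIdx j).map fun x => fFun c (w.get j) x).prod := by
  simp only [hopCoeff, one_mul, List.eraseIdx_eq_take_drop_succ, List.map_append, List.prod_append,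
    fFun]

/-- For `ε = -1` the factors before and after position `j` differ: they are `g(y, w_j) h(w_j, y)`
and `g(y, w_j) h(y, w_j)`. The orientation of `h` is the one found in `H`, so these factors are
exactly what `H` loses when `w_j` is removed. -/
theorem hopCoeff_neg_one (hc : c ≠ 0) {w : List (Fin N)} (hw : w.Nodup) (j : Fin w.length) :
    hopCoeff (-1 : Scal N) (gFun c) w j * bigH c (w.eraseIdx j)
      = ((w.eraseIdx j).map fun x => gFun c x (w.get j)).prod * bigH c w := by
  have hsplit : w = w.take j ++ w.get j :: w.drop (j + 1) := by simp
  have hd := hw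
  rw [hsplit, List.nodup_middle, List.nodup_cons, List.mem_append, not_or] at hd
  have e1 : ∀ y ∈ w.take j, (-1 : Scal N) * (1 + gFun c (w.get j) y)
      = gFun c y (w.get j) * hFun c (w.get j) y := by
    intro y hy
    have := gFun_ne_zero hc (x := w.get j) (y := y) (by rintro rfl; exact hd.1.1 hy)
    rw [hFun, fFun, gFun_anti (w.get j) y]
    field_simp
  have e2 : ∀ y ∈ w.drop (j + 1), 1 + (-1 : Scal N) * gFun c (w.get j) y
      = gFun c y (w.get j) * hFun c y (w.get j) := by
    intro y hy
    have := gFun_ne_zero hc (y := w.get j) (x := y) (by rintro rfl; exact hd.1.2 hy)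
    rw [hFun, fFun, gFun_anti y]
    field_simp
  have hH : bigH c w = ((w.take j).map fun y => hFun c (w.get j) y).prod
      * ((w.drop (j + 1)).map fun y => hFun c y (w.get j)).prod * bigH c (w.eraseIdx j) := by
    conv_lhs => rw [hsplit, bigH_append_cons, ← List.eraseIdx_eq_take_drop_succ]
  rw [hH, hopCoeff, List.map_congr_left e1, List.map_congr_left e2, List.prod_map_mul,
    List.prod_map_mul, List.eraseIdx_eq_take_drop_succ, List.map_append, List.prod_append]
  ring

end Coefficients

/-! ### Bethe vectors in terms of lattice words -/

section Recursion

variable {N : ℕ} {c : ℂ}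

theorem sgn_parity21_one : ((sgn (parity21 1) : ℤ) : Scal N) = 1 := by
  simp [parity21, sgn]

theorem sgn_parity12_one : ((sgn (parity12 1) : ℤ) : Scal N) = -1 := by
  simp [parity12, sgn]

theorem zsmul_smul_eq_scal {p : Fin 3 → ZMod 2} {V : Type*} [AddCommGroup V]
    [Module (Yangian p c) V] (n : ℤ) (X : YSeries N p c) (w : VSeries N p c V) :
    (n • X) • w = scal p c (n : Scal N) • X • w := by
  rw [← intCast_smul, scal_smul_def, mul_smul]

theorem neg_one_pow_eq (b : ℕ) : ((sgn (b : ZMod 2) : ℤ) : Scal N) = (-1) ^ b := by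
  induction b with
  | zero => simp [sgn_zero]
  | succ b ih =>
    have : ∀ q : ZMod 2, sgn (q + 1) = sgn q * -1 := by decide
    rw [Nat.cast_succ, this, Int.cast_mul, ih, pow_succ, Int.cast_neg, Int.cast_one]

theorem neg_one_pow_mul_self {K : Type*} [CommRing K] (b : ℕ) : (-1 : K) ^ b * (-1) ^ b = 1 := by
  rw [← mul_pow, neg_mul_neg, one_mul, one_pow]

theorem neg_one_pow_succ_div {K : Type*} [Field K] (b : ℕ) (x : K) :
    (-1) ^ (b + 1) / x = -((-1) ^ b / x) := by
  rw [pow_succ, mul_neg_one, neg_div]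

theorem Phi21_eq {V : Type*} [AddCommGroup V] [Module (Yangian parity21 c) V] (Ω : V)
    {u v : List (Fin N)} (huv : ∀ x ∈ u, ∀ y ∈ v, x ≠ y) :
    Phi21 c Ω u v = scal parity21 c (bigH c v)⁻¹ • betheWord parity21 c u v •
      constVec parity21 c Ω := by
  rw [Phi21, traceElement_eq rfl rfl u v huv, ← betheWord, zsmul_smul_eq_scal, ← mul_smul,
    ← scal_mul]
  congr 2
  have : ((v.length : ZMod 2) + u.length * parity21 1) = v.length := by simp [parity21]
  rw [this, neg_one_pow_eq, div_mul_eq_mul_div, neg_one_pow_mul_self, one_div]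

/-- The trace carries `(-1)^(a+b)` here, so the prefactor `(-1)^a` leaves `(-1)^b`; this is the
origin of the minus signs in the `Y(1|2)` recursion. -/
theorem Phi12_eq {V : Type*} [AddCommGroup V] [Module (Yangian parity12 c) V] (Ω : V)
    {u v : List (Fin N)} (huv : ∀ x ∈ u, ∀ y ∈ v, x ≠ y) :
    Phi12 c Ω u v = scal parity12 c ((-1) ^ v.length / bigH c u) • betheWord parity12 c u v •
      constVec parity12 c Ω := by
  rw [Phi12, traceElement_eq rfl rfl u v huv, ← betheWord, zsmul_smul_eq_scal, ← mul_smul,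
    ← scal_mul]
  congr 2
  have : ((v.length : ZMod 2) + u.length * parity12 1) = (v.length + u.length : ℕ) := by
    simp [parity12]
  rw [this, neg_one_pow_eq, div_mul_eq_mul_div, pow_add, mul_left_comm, neg_one_pow_mul_self,
    mul_one]

theorem smul_scal_smul {p : Fin 3 → ZMod 2} {V : Type*} [AddCommGroup V]
    [Module (Yangian p c) V] (X : YSeries N p c) (a : Scal N) (w : VSeries N p c V) :
    X • scal p c a • w = scal p c a • X • w := by
  rw [← mul_smul, ← scal_comm, mul_smul]

theorem scal_smul_scal_smul {p : Fin 3 → ZMod 2} {V : Type*} [AddCommGroup V]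
    [Module (Yangian p c) V] (a b : Scal N) (w : VSeries N p c V) :
    scal p c a • scal p c b • w = scal p c (a * b) • w := by
  rw [scal_mul, mul_smul]

end Recursion

end SuperYangian

end

open SuperYangian
theorem mainTheorem3 (c : ℂ) (hc : c ≠ 0) (N : ℕ)
    (u : List (Fin N)) (v₁ : Fin N) (v' : List (Fin N)) (huv : (u ++ v₁ :: v').Nodup) :
    (∀ (V : Type*) [AddCommGroup V] [Module (Yangian parity21 c) V] (Ω : V)
        (lam : Fin 3 → ℕ → ℂ), IsSingular parity21 c Ω lam →
      Phi21 c Ω u (v₁ :: v') =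
        scal parity21 c (v'.map fun v => hFun c v v₁).prod⁻¹ •
            monodromy parity21 c 1 2 v₁ • Phi21 c Ω u v' +
          scal parity21 c (v'.map fun v => hFun c v v₁).prod⁻¹ •
            ∑ j : Fin u.length,
              scal parity21 c (weight c (lam 1) (u.get j) * gFun c v₁ (u.get j) *
                  (v'.map fun v => fFun c v (u.get j)).prod *
                  ((u.eraseIdx j).map fun x => fFun c (u.get j) x).prod) •
                monodromy parity21 c 0 2 v₁ • Phi21 c Ω (u.eraseIdx j) v') ∧
    (∀ (V : Type*) [AddCommGroup V] [Module (Yangian parity12 c) V] (Ω : V)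
        (lam : Fin 3 → ℕ → ℂ), IsSingular parity12 c Ω lam →
      Phi12 c Ω u (v₁ :: v') =
        -(monodromy parity12 c 1 2 v₁ • Phi12 c Ω u v') -
          ∑ j : Fin u.length,
            scal parity12 c (weight c (lam 1) (u.get j) * gFun c (u.get j) v₁ *
                (v'.map fun v => fFun c (u.get j) v).prod *
                ((u.eraseIdx j).map fun x => gFun c x (u.get j)).prod) •
              monodromy parity12 c 0 2 v₁ • Phi12 c Ω (u.eraseIdx j) v') := by
  have hd := List.nodup_append.1 huv
  have h1 : ∀ x ∈ u, ∀ y ∈ v₁ :: v', x ≠ y := hd.2.2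
  have h2 : ∀ x ∈ u, ∀ y ∈ v', x ≠ y := fun x hx y hy => h1 x hx y (List.mem_cons_of_mem _ hy)
  have h3 : ∀ j : Fin u.length, ∀ x ∈ u.eraseIdx j, ∀ y ∈ v', x ≠ y := fun j x hx =>
    h2 x (List.mem_of_mem_eraseIdx hx)
  constructor
  · intro V _ _ Ω lam hΩ
    rw [Phi21_eq Ω h1, Phi21_eq Ω h2, betheWord_smul_constVec rfl hΩ u v₁ v' huv, bigH_cons,
      mul_inv, scal_mul, mul_smul, ← smul_add]
    refine congrArg (fun w => scal parity21 c _ • w) ?_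
    rw [smul_scal_smul, smul_add, Finset.smul_sum]
    refine congrArg _ (Finset.sum_congr rfl fun j _ => ?_)
    rw [Phi21_eq Ω (h3 j), scal_smul_scal_smul, smul_scal_smul, scal_smul_scal_smul,
      sgn_parity21_one, hopCoeff_one]
    refine congrArg (fun a => scal parity21 c a • _) ?_
    simp only [one_mul, fFun]
    ring
  · intro V _ _ Ω lam hΩ
    rw [Phi12_eq Ω h1, Phi12_eq Ω h2, betheWord_smul_constVec rfl hΩ u v₁ v' huv, smul_scal_smul,
      sub_eq_add_neg, smul_add, Finset.smul_sum, ← Finset.sum_neg_distrib]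
    have hneg : ∀ (a : Scal N) (w : VSeries N parity12 c V),
        -(scal parity12 c a • w) = scal parity12 c (-a) • w := fun a w => by
      have : scal parity12 c (-a) = -scal parity12 c a := map_neg (scalHom N parity12 c) a
      rw [this, neg_smul]
    have hH := bigH_ne_zero hc hd.1
    congr 1
    -- The row is unchanged in this term, so `H` is the same on both sides and only the sign of one
    -- extra horizontal line remains.
    · rw [hneg, List.length_cons, neg_one_pow_succ_div]
    · refine Finset.sum_congr rfl fun j _ => ?_
      have hHj := bigH_ne_zero hc (hd.1.sublist (List.eraseIdx_sublist u j))
      have hcoef := eq_div_of_mul_eq hHj (hopCoeff_neg_one hc hd.1 j)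
      rw [Phi12_eq Ω (h3 j), hneg, scal_smul_scal_smul, smul_scal_smul, scal_smul_scal_smul,
        sgn_parity12_one, hcoef]
      refine congrArg (fun a => scal parity12 c a • _) ?_
      -- Antisymmetry of `g` turns `1 - g(y, u_j)` into `f(u_j, y)`.
      have hf : (v'.map fun y => 1 + -1 * gFun c y (u.get j))
          = v'.map fun v => fFun c (u.get j) v :=
        List.map_congr_left fun y _ => by rw [fFun, gFun_anti y (u.get j)]; ring
      rw [hf, gFun_anti v₁ (u.get j), List.length_cons, pow_succ]
      field_simp
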